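/- Let $Q=(q_{ij})_{i,j\ge 0}$ be a skip-free generator matrix on $\{0,1,2,\dots\}$: $q_{ij}\ge 0$ for $i\ne j$, $q_{i,i+1}>0$, $q_{ij}=0$ for $j>i+1$, and $\sum_{j=0}^{i+1}q_{ij}=0$ for all $i\ge 0$. Let $(X_t)_{t\ge 0}$ be a Markov process on $\{0,1,2,\dots\}$ with generator $Q$ and $X_0=0$ almost surely; that is, its embedded chain $(Y_k)_{k\ge0}$ is a Markov chain started at $0$ with transition probabilities $p_{xy}=-q_{xy}/q_{xx}$ for $x\neq y$ and $p_{xx}=0$, and, for every $m\ge0$, given $Y_0,\dots,Y_m$ the first $m+1$ holding times are independent and exponential with rates $-q_{Y_kY_k}$, $0\le k\le m$. (Nothing is assumed about $X$ after a possible explosion.) Let $n\ge 0$, let $Q_n=(q_{ij})_{0\le i,j\le n-1}$, let $T_n=\inf\{t\ge 0: X_t=n\}$, and let $l_{T_n}^i=\int_0^{T_n}1_{\{X_s=i\}}\,ds$ for $0\le i\le n-1$. If $Q_n$ is not tridiagonal, that is, if $q_{ij}\neq 0$ for some $0\le i,j\le n-1$ with $|i-j|\ge 2$, then the sequence $(l_{T_n}^0,l_{T_n}^1,\dots,l_{T_n}^{n-1})$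 does not satisfy the Markov property: it is not the case that, for every $1\le k\le n-1$, the conditional distribution of $l_{T_n}^k$ given $(l_{T_n}^{0},\dots,l_{T_n}^{k-1})$ coincides almost surely with its conditional distribution given $l_{T_n}^{k-1}$ alone. -/

import Mathlib

open scoped NNReal ENNReal

namespace SkipFree

/-- `Q` is the generator matrix of a skip-free (to the left) process on `{0, 1, 2, …}`:
the off-diagonal entries are nonnegative rates, `q_{i,i+1} > 0`, `q_{ij} = 0` for `j > i + 1`,
and every row sums to zero. -/
structure IsSkipFreeGenerator (Q : Matrix ℕ ℕ ℝ) : Prop where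
  nonneg_of_ne : ∀ i j, i ≠ j → 0 ≤ Q i j
  up_pos : ∀ i, 0 < Q i (i + 1)
  skip_free : ∀ i j, i + 1 < j → Q i j = 0
  row_sum : ∀ i, ∑ j ∈ Finset.range (i + 2), Q i j = 0

/-- The upper left `n × n` submatrix `Q_n`, with rows and columns `0, …, n - 1`. -/
def upperSubmatrix (Q : Matrix ℕ ℕ ℝ) (n : ℕ) : Matrix (Fin n) (Fin n) ℝ :=
  Q.submatrix (fun i => (i : ℕ)) (fun j => (j : ℕ))

/-- A square matrix is tridiagonal if all entries at distance at least two from the diagonal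
vanish. -/
def IsTridiagonal {n : ℕ} (A : Matrix (Fin n) (Fin n) ℝ) : Prop :=
  ∀ i j : Fin n, ((i : ℕ) + 1 < (j : ℕ) ∨ (j : ℕ) + 1 < (i : ℕ)) → A i j = 0

/-- One step transition probabilities of the embedded chain, `p_{xy} = -q_{xy} / q_{xx}` for
`x ≠ y` and `p_{xx} = 0`. (A skip-free generator has `q_{xx} < 0` for every `x`.) -/
noncomputable def jumpProb (Q : Matrix ℕ ℕ ℝ) (x y : ℕ) : ℝ :=
  if x = y then 0 else -Q x y / Q x x

/-- The time `S_k` of the `k`-th transition, given the holding times; `S_0 = 0`. -/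
noncomputable def transitionTime {Ω : Type*} (H : ℕ → Ω → ℝ≥0) (k : ℕ) (ω : Ω) : ℝ≥0 :=
  ∑ m ∈ Finset.range k, H m ω

/-- The process `X` moves as a Markov jump process with generator `Q` started at `x₀`, whose
successive states are `Y 0, Y 1, …` and whose successive holding times are `H 0, H 1, …`.
Nothing is required of `X` after a possible explosion, that is, after the supremum of the
transition times. -/
structure IsJumpDescription {Ω : Type*} [MeasurableSpace Ω] (μ : MeasureTheory.Measure Ω)
    (Q : Matrix ℕ ℕ ℝ) (x₀ : ℕ) (X : ℝ≥0 → Ω → ℕ) (Y : ℕ → Ω → ℕ) (H : ℕ → Ω → ℝ≥0) :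
    Prop where
  measurable_state : ∀ k, Measurable (Y k)
  measurable_holding : ∀ k, Measurable (H k)
  /-- `X` stays at `Y k` during `[S_k, S_{k+1})`. -/
  path : ∀ᵐ ω ∂μ, ∀ (k : ℕ) (t : ℝ≥0),
    transitionTime H k ω ≤ t → t < transitionTime H (k + 1) ω → X t ω = Y k ω
  /-- `Y` is the Markov chain started at `x₀` with transition probabilities `jumpProb Q`. -/
  jump_chain : ∀ (m : ℕ) (y : ℕ → ℕ),
    μ {ω | ∀ k ≤ m, Y k ω = y k} =
      ENNReal.ofReal ((if y 0 = x₀ then 1 else 0) *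
        ∏ k ∈ Finset.range m, jumpProb Q (y k) (y (k + 1)))
  /-- Given `Y 0, …, Y m`, the holding times `H 0, …, H m` are independent, and `H k` is
  exponential with rate `-q_{Y_k Y_k}`. -/
  holding : ∀ (m : ℕ) (y : ℕ → ℕ) (t : ℕ → ℝ≥0),
    μ {ω | (∀ k ≤ m, Y k ω = y k) ∧ ∀ k ≤ m, t k < H k ω} =
      μ {ω | ∀ k ≤ m, Y k ω = y k} *
        ∏ k ∈ Finset.range (m + 1), ENNReal.ofReal (Real.exp (Q (y k) (y k) * (t k : ℝ)))

/-- `X = (X_t)_{t ≥ 0}` is a (continuous-time) Markov process on `{0, 1, 2, …}` with generator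
matrix `Q`, started at `x₀`. This is the definition by embedded chain and holding times, for a
generator `Q` without absorbing states. -/
def IsMarkovProcessFrom {Ω : Type*} [MeasurableSpace Ω] (μ : MeasureTheory.Measure Ω)
    (Q : Matrix ℕ ℕ ℝ) (x₀ : ℕ) (X : ℝ≥0 → Ω → ℕ) : Prop :=
  (∀ t, Measurable (X t)) ∧
    ∃ (Y : ℕ → Ω → ℕ) (H : ℕ → Ω → ℝ≥0), IsJumpDescription μ Q x₀ X Y H

/-- The occupation time `l_{T_n}^i`: the Lebesgue measure of the set of times `t < T_n` with
`X_t = i`, where `T_n` is the first time that `X` reaches `n` (`⊤` if it never does). -/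
noncomputable def occupationTime {Ω : Type*} (X : ℝ≥0 → Ω → ℕ) (n i : ℕ) (ω : Ω) : ℝ≥0∞ :=
  MeasureTheory.volume
    ((fun t : ℝ≥0 => (t : ℝ)) ''
      {t | X t ω = i ∧ (t : WithTop ℝ≥0) < MeasureTheory.hittingAfter X {n} 0 ω})

/-- The finite sequence `Z_0, …, Z_{n-1}` of random variables has the Markov property: for every
`k` with `k + 1 ≤ n - 1`, the conditional distribution of `Z_{k+1}` given `(Z_0, …, Z_k)` is its
conditional distribution given `Z_k` alone. No time-homogeneity is required. -/
def HasMarkovProperty {Ω E : Type*} [MeasurableSpace Ω] [MeasurableSpace E]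
    [StandardBorelSpace E] [Nonempty E] (μ : MeasureTheory.Measure Ω)
    [MeasureTheory.IsFiniteMeasure μ] {n : ℕ} (Z : Fin n → Ω → E) : Prop :=
  ∀ (k : ℕ) (hk : k + 1 < n), ∀ᵐ ω ∂μ,
    ProbabilityTheory.condDistrib (Z ⟨k + 1, hk⟩)
        (fun ω' (j : Fin (k + 1)) => Z (j.castLE hk.le) ω') μ
        (fun j : Fin (k + 1) => Z (j.castLE hk.le) ω) =
      ProbabilityTheory.condDistrib (Z ⟨k + 1, hk⟩) (Z ⟨k, Nat.lt_of_succ_lt hk⟩) μ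
        (Z ⟨k, Nat.lt_of_succ_lt hk⟩ ω)

end SkipFree

/-
Let `T` be the hitting time of `n` and let `P_l` be the function with `P_l(0) = 1` that is harmonic
for the process killed at rate `l i` in each state `i`. Optional stopping gives the joint Laplace
transform of the occupation times: `E[exp (-∑ l i * l_T^i)] = 1 / P_l(n)`.

Since `Q_n` is not tridiagonal, there is a jump from some state `i + 2` to some `j ≤ i`. Kill only
at `i`, `i + 1`, `i + 2`, with rates `s`, `t`, `u`, and write `P(s, t, u)` for `P_l(n)`. For some
`A` and `γ` one has `A * P(0, t, 1) = P(0, t + γ, 0)` for every `t`, that is,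
`E[exp (-l_T^{i+2}) | l_T^{i+1}] = A * exp (-γ * l_T^{i+1})`. Under the Markov property this is also
the conditional expectation given `l_T^0, …, l_T^{i+1}`, so that `A * P(s, 0, 1) = P(s, γ, 0)` for
every `s`; the jump from `i + 2` to `j` makes this fail for some `s > 0`.
-/

namespace SkipFree

open MeasureTheory ProbabilityTheory Finset Filter BoundedContinuousFunction
open scoped Topology

section Harmonic

variable {Q : Matrix ℕ ℕ ℝ} {l l' v w : ℕ → ℝ} {k k' : ℕ}

lemma IsSkipFreeGenerator.diag_neg (hQ : IsSkipFreeGenerator Q) (i : ℕ) : Q i i < 0 := by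
  have hrow := hQ.row_sum i
  rw [sum_range_succ, sum_range_succ] at hrow
  have hsum : 0 ≤ ∑ j ∈ range i, Q i j :=
    sum_nonneg fun j hj => hQ.nonneg_of_ne i j (mem_range.mp hj).ne'
  linarith [hQ.up_pos i]

/-- The sequence `v` satisfies `(Q v) i = l i * v i` at every state `i ≥ k`, i.e. it is harmonic
there for the skip-free process with generator `Q` killed at rate `l`. The row `i` of `Q` is
supported on `{0, …, i + 1}`. -/
def IsHarmonicFrom (Q : Matrix ℕ ℕ ℝ) (l : ℕ → ℝ) (k : ℕ) (v : ℕ → ℝ) : Prop :=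
  ∀ i, k ≤ i → ∑ j ∈ range (i + 2), Q i j * v j = l i * v i

namespace IsHarmonicFrom

lemma mono (hv : IsHarmonicFrom Q l k v) (hk : k ≤ k') : IsHarmonicFrom Q l k' v :=
  fun i hi => hv i (hk.trans hi)

lemma congr_rates (hv : IsHarmonicFrom Q l k v) (h : ∀ i, k ≤ i → l i * v i = l' i * v i) :
    IsHarmonicFrom Q l' k v :=
  fun i hi => (hv i hi).trans (h i hi)

lemma add (hv : IsHarmonicFrom Q l k v) (hw : IsHarmonicFrom Q l k w) :
    IsHarmonicFrom Q l k (v + w) := fun i hi => by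
  simp only [Pi.add_apply, mul_add, sum_add_distrib, hv i hi, hw i hi]

lemma smul (hv : IsHarmonicFrom Q l k v) (c : ℝ) : IsHarmonicFrom Q l k (c • v) := fun i hi => by
  simp only [Pi.smul_apply, smul_eq_mul, mul_left_comm _ c, ← mul_sum, hv i hi]

lemma neg (hv : IsHarmonicFrom Q l k v) : IsHarmonicFrom Q l k (-v) := by
  simpa only [neg_one_smul] using hv.smul (-1)

lemma sub (hv : IsHarmonicFrom Q l k v) (hw : IsHarmonicFrom Q l k w) :
    IsHarmonicFrom Q l k (v - w) := by
  simpa only [sub_eq_add_neg] using hv.add hw.neg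

lemma mul_increment (hQ : IsSkipFreeGenerator Q) (hv : IsHarmonicFrom Q l k v) {i : ℕ}
    (hi : k ≤ i) :
    Q i (i + 1) * (v (i + 1) - v i) = l i * v i + ∑ j ∈ range i, Q i j * (v i - v j) := by
  have hrow := hQ.row_sum i
  have hharm := hv i hi
  rw [sum_range_succ, sum_range_succ] at hrow hharm
  simp only [mul_sub, sum_sub_distrib, ← sum_mul]
  linear_combination hharm - v i * hrow

lemma eq_of_eqOn (hQ : IsSkipFreeGenerator Q) (hv : IsHarmonicFrom Q l k v)
    (hw : IsHarmonicFrom Q l k w) (h : ∀ j ≤ k, v j = w j) : v = w := by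
  have agree (m : ℕ) (hm : k ≤ m) : ∀ j ≤ m, v j = w j := by
    induction m, hm using Nat.le_induction with
    | base => exact h
    | succ i hi ih =>
      have hsum : ∑ j ∈ range i, Q i j * (v i - v j) = ∑ j ∈ range i, Q i j * (w i - w j) :=
        sum_congr rfl fun j hj => by rw [ih i le_rfl, ih j (mem_range.mp hj).le]
      have hinc : Q i (i + 1) * (v (i + 1) - v i) = Q i (i + 1) * (w (i + 1) - w i) := by
        rw [hv.mul_increment hQ hi, hw.mul_increment hQ hi, hsum, ih i le_rfl]
      have hnext := mul_left_cancel₀ (hQ.up_pos i).ne' hinc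
      rw [ih i le_rfl, sub_left_inj] at hnext
      exact fun j hj => (Nat.le_succ_iff.mp hj).elim (ih j) fun hj => hj ▸ hnext
  exact funext fun j => agree (max k j) (le_max_left k j) j (le_max_right k j)

lemma maximum_principle (hQ : IsSkipFreeGenerator Q) (hv : IsHarmonicFrom Q l k v)
    (hl : ∀ i, k ≤ i → 0 ≤ l i) (hvk : 0 ≤ v k) (hmax : ∀ j ≤ k, v j ≤ v k) {m : ℕ}
    (hm : k ≤ m) : ∀ j ≤ m, v j ≤ v m := by
  induction m, hm using Nat.le_induction with
  | base => exact hmax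
  | succ i hi ih =>
    have hrhs : 0 ≤ l i * v i + ∑ j ∈ range i, Q i j * (v i - v j) :=
      add_nonneg (mul_nonneg (hl i hi) (hvk.trans (ih k hi))) <| sum_nonneg fun j hj =>
        mul_nonneg (hQ.nonneg_of_ne i j (mem_range.mp hj).ne')
          (sub_nonneg.mpr (ih j (mem_range.mp hj).le))
    rw [← hv.mul_increment hQ hi, mul_nonneg_iff_of_pos_left (hQ.up_pos i), sub_nonneg] at hrhs
    exact fun j hj =>
      (Nat.le_succ_iff.mp hj).elim (fun h => (ih j h).trans hrhs) fun h => h ▸ le_rfl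

end IsHarmonicFrom

/-- The sequence that agrees with `a` up to the index `k` and is harmonic from `k` on for the
killing rates `l`. -/
noncomputable def harmonicExtension (Q : Matrix ℕ ℕ ℝ) (l : ℕ → ℝ) (k : ℕ) (a : ℕ → ℝ) : ℕ → ℝ
  | 0 => a 0
  | i + 1 =>
    if i + 1 ≤ k then a (i + 1)
    else (l i * harmonicExtension Q l k a i -
      ∑ j : Fin (i + 1), Q i j * harmonicExtension Q l k a j) / Q i (i + 1)

lemma harmonicExtension_of_le {a : ℕ → ℝ} {i : ℕ} (h : i ≤ k) :
    harmonicExtension Q l k a i = a i := by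
  cases i with
  | zero => rw [harmonicExtension]
  | succ i => rw [harmonicExtension, if_pos h]

lemma isHarmonicFrom_harmonicExtension (hQ : IsSkipFreeGenerator Q) (l : ℕ → ℝ) (k : ℕ)
    (a : ℕ → ℝ) : IsHarmonicFrom Q l k (harmonicExtension Q l k a) := fun i hi => by
  rw [sum_range_succ, harmonicExtension.eq_2, if_neg (by omega),
    mul_div_cancel₀ _ (hQ.up_pos i).ne',
    Fin.sum_univ_eq_sum_range (fun j => Q i j * harmonicExtension Q l k a j), add_sub_cancel]

/-- The harmonic function of the skip-free process with generator `Q` killed at rate `l`,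
normalized by its value `1` at `0`. Its value at `n` is the inverse of the probability that the
killed process started at `0` reaches `n`. -/
noncomputable def harmonicFun (Q : Matrix ℕ ℕ ℝ) (l : ℕ → ℝ) : ℕ → ℝ :=
  harmonicExtension Q l 0 1

lemma harmonicFun_zero (Q : Matrix ℕ ℕ ℝ) (l : ℕ → ℝ) : harmonicFun Q l 0 = 1 :=
  harmonicExtension_of_le le_rfl

lemma isHarmonicFrom_harmonicFun (hQ : IsSkipFreeGenerator Q) (l : ℕ → ℝ) :
    IsHarmonicFrom Q l 0 (harmonicFun Q l) :=
  isHarmonicFrom_harmonicExtension hQ l 0 1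

lemma monotone_harmonicFun (hQ : IsSkipFreeGenerator Q) (hl : ∀ i, 0 ≤ l i) :
    Monotone (harmonicFun Q l) := fun i m him =>
  (isHarmonicFrom_harmonicFun hQ l).maximum_principle hQ (fun i _ => hl i)
    (by rw [harmonicFun_zero]; exact zero_le_one) (fun j hj => by rw [Nat.le_zero.mp hj])
    m.zero_le i him

lemma one_le_harmonicFun (hQ : IsSkipFreeGenerator Q) (hl : ∀ i, 0 ≤ l i) (i : ℕ) :
    1 ≤ harmonicFun Q l i :=
  (harmonicFun_zero Q l).ge.trans (monotone_harmonicFun hQ hl i.zero_le)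

lemma harmonicFun_eq_one (hQ : IsSkipFreeGenerator Q) {m : ℕ} (hl : ∀ i < m, l i = 0) :
    ∀ j ≤ m, harmonicFun Q l j = 1 := by
  induction m with
  | zero => exact fun j hj => Nat.le_zero.mp hj ▸ harmonicFun_zero Q l
  | succ m ih =>
    have hle := ih fun i hi => hl i (hi.trans m.lt_succ_self)
    have hinc := (isHarmonicFrom_harmonicFun hQ l).mul_increment hQ m.zero_le
    rw [hl m m.lt_succ_self, zero_mul, zero_add, sum_eq_zero fun j hj => by
      rw [hle m le_rfl, hle j (mem_range.mp hj).le, sub_self, mul_zero], hle m le_rfl,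
      mul_eq_zero, or_iff_right (hQ.up_pos m).ne', sub_eq_zero] at hinc
    exact fun j hj => (Nat.le_succ_iff.mp hj).elim (hle j) fun hj => hj ▸ hinc

end Harmonic

section KillingRates

/-- Killing at the three consecutive states `i`, `i + 1`, `i + 2` only, with the rates `s`, `t`,
`u`. -/
def killingRates (i : ℕ) (s t u : ℝ) : ℕ → ℝ :=
  Pi.single i s + Pi.single (i + 1) t + Pi.single (i + 2) u

variable {Q : Matrix ℕ ℕ ℝ} {i n : ℕ}

lemma killingRates_nonneg {s t u : ℝ} (hs : 0 ≤ s) (ht : 0 ≤ t) (hu : 0 ≤ u) :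
    0 ≤ killingRates i s t u :=
  add_nonneg (add_nonneg (Pi.single_nonneg.mpr hs) (Pi.single_nonneg.mpr ht))
    (Pi.single_nonneg.mpr hu)

lemma killingRates_of_lt {j : ℕ} (s t u : ℝ) (hj : j < i) : killingRates i s t u j = 0 := by
  simp [killingRates, hj.ne, show j ≠ i + 1 by omega, show j ≠ i + 2 by omega]

lemma killingRates_of_le {j : ℕ} (s t u : ℝ) (hj : i + 2 ≤ j) :
    killingRates i s t u j = Pi.single (M := fun _ => ℝ) (i + 2) u j := by
  simp [killingRates, Pi.single_apply, show j ≠ i by omega, show j ≠ i + 1 by omega]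

lemma harmonicFun_killingRates_of_le (hQ : IsSkipFreeGenerator Q) (s t u : ℝ) {j : ℕ}
    (hj : j ≤ i) : harmonicFun Q (killingRates i s t u) j = 1 :=
  harmonicFun_eq_one hQ (fun _ h => killingRates_of_lt s t u h) j hj

lemma harmonicFun_killingRates_succ (hQ : IsSkipFreeGenerator Q) (i : ℕ) (s t u : ℝ) :
    harmonicFun Q (killingRates i s t u) (i + 1) = 1 + s / Q i (i + 1) := by
  have hinc := (isHarmonicFrom_harmonicFun hQ (killingRates i s t u)).mul_increment hQ i.zero_le
  have hone := fun j (hj : j ≤ i) => harmonicFun_killingRates_of_le hQ s t u hj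
  rw [sum_eq_zero fun j hj => by
    rw [hone i le_rfl, hone j (mem_range.mp hj).le, sub_self, mul_zero], hone i le_rfl] at hinc
  have hs : killingRates i s t u i = s := by simp [killingRates]
  rw [hs] at hinc
  have hp := (hQ.up_pos i).ne'
  field_simp
  linear_combination hinc

lemma harmonicFun_killingRates_succ_succ (hQ : IsSkipFreeGenerator Q) (i : ℕ) (s t u : ℝ) :
    harmonicFun Q (killingRates i s t u) (i + 2) =
      1 + s / Q i (i + 1) + (t * (1 + s / Q i (i + 1)) +
        (∑ j ∈ range (i + 1), Q (i + 1) j) * (s / Q i (i + 1))) / Q (i + 1) (i + 2) := by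
  have hinc := (isHarmonicFrom_harmonicFun hQ (killingRates i s t u)).mul_increment hQ
    (i + 1).zero_le
  rw [sum_congr rfl fun j hj => by
    rw [harmonicFun_killingRates_of_le hQ s t u (Nat.lt_succ_iff.mp (mem_range.mp hj))],
    ← sum_mul, harmonicFun_killingRates_succ hQ] at hinc
  have ht : killingRates i s t u (i + 1) = t := by simp [killingRates]
  rw [ht, add_sub_cancel_left] at hinc
  rw [← hinc, mul_div_cancel_left₀ _ (hQ.up_pos (i + 1)).ne', add_sub_cancel]

lemma harmonicExtension_neg_of_rate_pos (hQ : IsSkipFreeGenerator Q) (hn : i + 2 < n) {j : ℕ}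
    (hj : j ≤ i) (hpos : 0 < Q (i + 2) j) :
    harmonicExtension Q 0 (i + 2) (fun m => if m ≤ i then 1 else 0) n < 0 := by
  set v := harmonicExtension Q 0 (i + 2) (fun m => if m ≤ i then 1 else 0)
  have hv : IsHarmonicFrom Q 0 (i + 2) v := isHarmonicFrom_harmonicExtension hQ _ _ _
  have hval (m : ℕ) (hm : m ≤ i + 2) : v m = if m ≤ i then 1 else 0 := harmonicExtension_of_le hm
  have hk : v (i + 2) = 0 := by rw [hval _ le_rfl, if_neg (by omega)]
  have hle (m : ℕ) (hm : m ≤ i + 2) : 0 ≤ v m := by rw [hval m hm]; positivity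
  have hfirst : v (i + 3) < 0 := by
    have hinc := hv.mul_increment hQ le_rfl
    rw [hk, mul_zero, zero_add, sub_zero] at hinc
    refine neg_of_mul_neg_right (b := v (i + 3)) (hinc.trans_lt ?_) (hQ.up_pos (i + 2)).le
    refine sum_neg' (fun m hm => ?_) ⟨j, mem_range.mpr (by omega), ?_⟩
    · have := mul_nonneg (hQ.nonneg_of_ne (i + 2) m (mem_range.mp hm).ne')
        (hle m (mem_range.mp hm).le)
      linarith
    · rw [hval j (by omega), if_pos hj]
      linarith
  have hmax := hv.neg.maximum_principle hQ (fun _ _ => le_rfl) (by simp [hk])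
    (fun m hm => by simpa [hk] using hle m hm) hn.le (i + 3) hn
  exact (neg_le_neg_iff.mp hmax).trans_lt hfirst

lemma harmonicExtension_single_nonpos (hQ : IsSkipFreeGenerator Q) {j k : ℕ} (hjk : j < k)
    (hn : k ≤ n) : harmonicExtension Q 0 k (Pi.single j 1) n ≤ 0 := by
  have hv := isHarmonicFrom_harmonicExtension hQ 0 k (Pi.single j 1)
  have hk : harmonicExtension Q 0 k (Pi.single j 1) k = 0 := by
    rw [harmonicExtension_of_le le_rfl, Pi.single_eq_of_ne hjk.ne']
  have hmax := hv.neg.maximum_principle hQ (fun _ _ => le_rfl) (by simp [hk])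
    (fun m hm => by
      simp only [Pi.neg_apply, hk, neg_le_neg_iff, harmonicExtension_of_le hm, Pi.single_apply]
      positivity) hn k hn
  simpa [hk] using hmax

lemma one_le_harmonicExtension_single (hQ : IsSkipFreeGenerator Q) {l : ℕ → ℝ} {k : ℕ}
    (hl : ∀ i, k ≤ i → 0 ≤ l i) (hn : k ≤ n) :
    1 ≤ harmonicExtension Q l k (Pi.single k 1) n := by
  have hval (m : ℕ) (hm : m ≤ k) := harmonicExtension_of_le (Q := Q) (l := l)
    (a := Pi.single k 1) hm
  have hk := hval k le_rfl
  rw [Pi.single_eq_same] at hk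
  have hmax := (isHarmonicFrom_harmonicExtension hQ l k (Pi.single k 1)).maximum_principle hQ hl
    (by rw [hk]; exact zero_le_one)
    (fun m hm => by rw [hk, hval m hm, Pi.single_apply]; split_ifs <;> simp) hn k hn
  exact hk.ge.trans hmax

lemma strictMono_harmonicExtension_single (hQ : IsSkipFreeGenerator Q) {k : ℕ} (hn : k < n) :
    StrictMono fun u : ℝ => harmonicExtension Q (Pi.single k u) k (Pi.single k 1) n := by
  intro u u' hu
  set v := harmonicExtension Q (Pi.single k u) k (Pi.single k 1)
  set v' := harmonicExtension Q (Pi.single k u') k (Pi.single k 1)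
  have hval (m : ℕ) (hm : m ≤ k) : v m = Pi.single (M := fun _ => ℝ) k 1 m :=
    harmonicExtension_of_le hm
  have hval' (m : ℕ) (hm : m ≤ k) : v' m = Pi.single (M := fun _ => ℝ) k 1 m :=
    harmonicExtension_of_le hm
  have hv : IsHarmonicFrom Q (Pi.single k u) k v := isHarmonicFrom_harmonicExtension hQ _ _ _
  have hv' : IsHarmonicFrom Q (Pi.single k u') k v' := isHarmonicFrom_harmonicExtension hQ _ _ _
  have hfirst : v (k + 1) < v' (k + 1) := by
    have hinc := hv.mul_increment hQ le_rfl
    have hinc' := hv'.mul_increment hQ le_rfl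
    rw [sum_congr rfl fun j hj => by rw [hval k le_rfl, hval j (mem_range.mp hj).le],
      hval k le_rfl, Pi.single_eq_same, Pi.single_eq_same, mul_one] at hinc
    rw [sum_congr rfl fun j hj => by rw [hval' k le_rfl, hval' j (mem_range.mp hj).le],
      hval' k le_rfl, Pi.single_eq_same, Pi.single_eq_same, mul_one] at hinc'
    exact lt_of_mul_lt_mul_left (by linarith) (hQ.up_pos k).le
  have hrates (c : ℝ) (x : ℕ → ℝ) (i : ℕ) (hi : k + 1 ≤ i) :
      (Pi.single k c : ℕ → ℝ) i * x i = (0 : ℕ → ℝ) i * x i := by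
    rw [Pi.single_eq_of_ne (by omega), Pi.zero_apply]
  have hdiff : IsHarmonicFrom Q 0 (k + 1) (v' - v) :=
    ((hv'.mono k.le_succ).congr_rates (hrates u' v')).sub
      ((hv.mono k.le_succ).congr_rates (hrates u v))
  have hmax := hdiff.maximum_principle hQ (fun _ _ => le_rfl) (sub_nonneg.mpr hfirst.le)
    (fun j hj => (Nat.le_succ_iff.mp hj).elim
      (fun h => by simp [hval j h, hval' j h, hfirst.le]) fun h => h ▸ le_rfl) hn (k + 1) hn
  exact sub_pos.mp ((sub_pos.mpr hfirst).trans_le hmax)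

lemma harmonicFun_killingRates_eq (hQ : IsSkipFreeGenerator Q) (i : ℕ) (s t u : ℝ) :
    harmonicFun Q (killingRates i s t u) =
      harmonicExtension Q 0 (i + 2) (fun m => if m ≤ i then 1 else 0) +
      harmonicFun Q (killingRates i s t u) (i + 1) •
        harmonicExtension Q 0 (i + 2) (Pi.single (i + 1) 1) +
      harmonicFun Q (killingRates i s t u) (i + 2) •
        harmonicExtension Q (Pi.single (i + 2) u) (i + 2) (Pi.single (i + 2) 1) := by
  have hrates (a : ℕ → ℝ) (ha : a (i + 2) = 0) : IsHarmonicFrom Q (Pi.single (i + 2) u) (i + 2)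
      (harmonicExtension Q 0 (i + 2) a) := by
    refine (isHarmonicFrom_harmonicExtension hQ 0 (i + 2) a).congr_rates fun j hj => ?_
    rcases hj.eq_or_lt with rfl | hj
    · rw [harmonicExtension_of_le le_rfl, ha, mul_zero, mul_zero]
    · rw [Pi.single_eq_of_ne hj.ne', Pi.zero_apply]
  refine IsHarmonicFrom.eq_of_eqOn hQ
    (((isHarmonicFrom_harmonicFun hQ _).mono (i + 2).zero_le).congr_rates fun j hj => by
      rw [killingRates_of_le s t u hj])
    (((hrates _ (by simp)).add ((hrates _ (by simp)).smul _)).add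
      ((isHarmonicFrom_harmonicExtension hQ _ _ _).smul _)) fun j hj => ?_
  simp only [Pi.add_apply, Pi.smul_apply, smul_eq_mul, harmonicExtension_of_le hj]
  obtain hj | rfl | rfl : j ≤ i ∨ j = i + 1 ∨ j = i + 2 := by omega
  · simp [harmonicFun_killingRates_of_le hQ s t u hj, hj, show j ≠ i + 1 by omega,
      show j ≠ i + 2 by omega]
  · simp
  · simp

lemma exists_scaling_harmonicFun_killingRates (hQ : IsSkipFreeGenerator Q) (hn : i + 2 < n) {j : ℕ}
    (hj : j ≤ i) (hpos : 0 < Q (i + 2) j) :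
    ∃ A γ s : ℝ, 0 < A ∧ 0 ≤ γ ∧ 0 ≤ s ∧
      (∀ t, A * harmonicFun Q (killingRates i 0 t 1) n =
        harmonicFun Q (killingRates i 0 (t + γ) 0) n) ∧
      A * harmonicFun Q (killingRates i s 0 1) n ≠ harmonicFun Q (killingRates i s γ 0) n := by
  set a := harmonicExtension Q 0 (i + 2) (fun m => if m ≤ i then 1 else 0) n
  set b := harmonicExtension Q 0 (i + 2) (Pi.single (i + 1) 1) n
  set e : ℝ → ℝ := fun u =>
    harmonicExtension Q (Pi.single (i + 2) u) (i + 2) (Pi.single (i + 2) 1) n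
  have ha : a < 0 := harmonicExtension_neg_of_rate_pos hQ hn hj hpos
  have hb : b ≤ 0 := harmonicExtension_single_nonpos hQ (i + 1).lt_succ_self hn.le
  have he0 : 0 < e 0 := zero_lt_one.trans_le <|
    one_le_harmonicExtension_single hQ (fun m _ => by simp) hn.le
  have he01 : e 0 < e 1 := strictMono_harmonicExtension_single hQ hn zero_lt_one
  have he1 : 0 < e 1 := he0.trans he01
  have hp := hQ.up_pos i
  have hq : 0 < Q (i + 1) (i + 2) := hQ.up_pos (i + 1)
  set A := e 0 / e 1
  have hAe : A * e 1 = e 0 := div_mul_cancel₀ _ he1.ne'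
  have hA1 : A < 1 := (div_lt_one he1).mpr he01
  set γ := (1 - A) * -(a + b) * Q (i + 1) (i + 2) / e 0
  have hγ : e 0 * γ / Q (i + 1) (i + 2) = (A - 1) * (a + b) := by
    simp only [γ]
    field_simp
    ring
  have hD (s t u : ℝ) : harmonicFun Q (killingRates i s t u) n =
      a + harmonicFun Q (killingRates i s t u) (i + 1) * b +
        harmonicFun Q (killingRates i s t u) (i + 2) * e u :=
    congrFun (harmonicFun_killingRates_eq hQ i s t u) n
  simp only [harmonicFun_killingRates_succ hQ, harmonicFun_killingRates_succ_succ hQ] at hD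
  refine ⟨A, γ, Q i (i + 1), div_pos he0 he1, ?_, hp.le, fun t => ?_, fun heq => ?_⟩
  · exact div_nonneg (mul_nonneg (mul_nonneg (by linarith) (by linarith)) hq.le) he0.le
  · rw [hD, hD]
    linear_combination (1 + t / Q (i + 1) (i + 2)) * hAe - hγ
  · rw [hD, hD, div_self hp.ne'] at heq
    have hzero : (1 - A) * a = 0 := by
      linear_combination heq - (2 + (∑ j ∈ range (i + 1), Q (i + 1) j) / Q (i + 1) (i + 2)) * hAe
        + 2 * hγ
    exact (mul_neg_of_pos_of_neg (sub_pos.mpr hA1) ha).ne hzero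

end KillingRates

section ExponentialLaw

lemma expMeasure_Ioi {r : ℝ} (hr : 0 < r) (t : ℝ) :
    expMeasure r (Set.Ioi t) = ENNReal.ofReal (Real.exp (-(r * max t 0))) := by
  have := isProbabilityMeasure_expMeasure hr
  rw [← Set.compl_Iic, prob_compl_eq_one_sub measurableSet_Iic, ← ofReal_cdf,
    cdf_expMeasure_eq hr, ← ENNReal.ofReal_one]
  split_ifs with ht
  · rw [← ENNReal.ofReal_sub _ (by simp [mul_nonneg hr.le ht]), max_eq_left ht, sub_sub_cancel]
  · simp [(not_le.mp ht).le]

lemma lintegral_exp_neg_expMeasure {r l : ℝ} (hr : 0 < r) (hl : 0 ≤ l) :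
    ∫⁻ x, ENNReal.ofReal (Real.exp (-(l * x))) ∂expMeasure r = ENNReal.ofReal (r / (l + r)) := by
  have hlr : 0 < l + r := by linarith
  have htilt (x : ℝ) : exponentialPDF r x * ENNReal.ofReal (Real.exp (-(l * x))) =
      ENNReal.ofReal (r / (l + r)) * exponentialPDF (l + r) x := by
    rw [exponentialPDF_eq, exponentialPDF_eq]
    split_ifs
    · rw [← ENNReal.ofReal_mul (by positivity), ← ENNReal.ofReal_mul (by positivity), mul_assoc,
        ← Real.exp_add, ← mul_assoc, div_mul_cancel₀ _ hlr.ne']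
      ring_nf
    · simp
  have hmeas (c : ℝ) : Measurable (exponentialPDF c) :=
    (measurable_exponentialPDFReal c).ennreal_ofReal
  change ∫⁻ x, _ ∂(volume.withDensity (exponentialPDF r)) = _
  rw [lintegral_withDensity_eq_lintegral_mul _ (hmeas r) (by fun_prop)]
  simp only [Pi.mul_apply, htilt]
  rw [lintegral_const_mul _ (hmeas _), lintegral_exponentialPDF_eq_one hlr, mul_one]

lemma eq_smul_pi_expMeasure_of_tail {ι : Type*} [Fintype ι] {ν : Measure (ι → ℝ)}
    [IsFiniteMeasure ν] {r : ι → ℝ} (hr : ∀ k, 0 < r k)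
    (htail : ∀ t : ι → ℝ, ν (Set.univ.pi fun k => Set.Ioi (t k)) =
      ν Set.univ * ∏ k, expMeasure (r k) (Set.Ioi (t k))) :
    ν = ν Set.univ • Measure.pi fun k => expMeasure (r k) := by
  have := fun k => isProbabilityMeasure_expMeasure (hr k)
  refine ext_of_generate_finite _
    (generateFrom_eq_pi (C := fun _ => Set.range Set.Ioi) (fun _ => ?_) fun _ => ?_).symm
    (IsPiSystem.pi fun _ => ?_) ?_ ?_
  · rw [← borel_eq_generateFrom_Ioi, BorelSpace.measurable_eq (α := ℝ)]
  · refine ⟨fun m => Set.Ioi (-(m : ℝ)), fun m => ⟨_, rfl⟩, Set.eq_univ_of_forall fun x => ?_⟩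
    obtain ⟨m, hm⟩ := exists_nat_gt (-x)
    exact Set.mem_iUnion.mpr ⟨m, neg_lt.mp hm⟩
  · exact isPiSystem_Ioi
  · rintro _ ⟨s, hs, rfl⟩
    choose t ht using fun k => hs k (Set.mem_univ k)
    obtain rfl : (fun k => Set.Ioi (t k)) = s := funext ht
    rw [htail t, Measure.smul_apply, Measure.pi_pi, smul_eq_mul]
  · simp

lemma lintegral_pi_prod {ι : Type*} [Fintype ι] {E : ι → Type*} [∀ k, MeasurableSpace (E k)]
    (ρ : ∀ k, Measure (E k)) [∀ k, IsProbabilityMeasure (ρ k)] {F : ∀ k, E k → ℝ≥0∞}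
    (hF : ∀ k, Measurable (F k)) :
    ∫⁻ x, ∏ k, F k (x k) ∂(Measure.pi ρ) = ∏ k, ∫⁻ x, F k x ∂ρ k := by
  have hindep : iIndepFun (fun k (x : ∀ k, E k) => F k (x k)) (Measure.pi ρ) :=
    iIndepFun_pi fun k => (hF k).aemeasurable
  refine (lintegral_prod_eq_prod_lintegral_of_indepFun univ _ hindep fun k =>
    (hF k).comp (measurable_pi_apply k)).trans ?_
  exact prod_congr rfl fun k _ => (measurePreserving_eval ρ k).lintegral_comp (hF k)

end ExponentialLaw

section JumpMean

variable {Q : Matrix ℕ ℕ ℝ}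

lemma IsSkipFreeGenerator.jumpProb_nonneg (hQ : IsSkipFreeGenerator Q) (x y : ℕ) :
    0 ≤ jumpProb Q x y := by
  rw [jumpProb]
  split_ifs with h
  · exact le_rfl
  · exact div_nonneg_of_nonpos (neg_nonpos.mpr (hQ.nonneg_of_ne x y h)) (hQ.diag_neg x).le

/-- The mean of `f` at the state that follows `x` in the embedded chain. -/
noncomputable def jumpMean (Q : Matrix ℕ ℕ ℝ) (f : ℕ → ℝ≥0∞) (x : ℕ) : ℝ≥0∞ :=
  ∑' z, ENNReal.ofReal (jumpProb Q x z) * f z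

lemma jumpMean_eq_ofReal (hQ : IsSkipFreeGenerator Q) {x : ℕ} {f : ℕ → ℝ≥0∞} {v : ℕ → ℝ}
    (hv : ∀ j ≤ x + 1, 0 ≤ v j) (hf : ∀ j ≤ x + 1, f j = ENNReal.ofReal (v j)) :
    jumpMean Q f x =
      ENNReal.ofReal ((∑ j ∈ range (x + 2), Q x j * v j - Q x x * v x) / -Q x x) := by
  have hdiag := (hQ.diag_neg x).ne
  have hterm (j : ℕ) : jumpProb Q x j * v j * -Q x x =
      Q x j * v j - if j = x then Q x x * v x else 0 := by
    rw [jumpProb]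
    rcases eq_or_ne x j with rfl | h
    · simp
    · rw [if_neg h, if_neg h.symm]
      field_simp
      ring
  have hsum : ∑ j ∈ range (x + 2), jumpProb Q x j * v j =
      (∑ j ∈ range (x + 2), Q x j * v j - Q x x * v x) / -Q x x := by
    rw [eq_div_iff (neg_ne_zero.mpr hdiag), sum_mul, sum_congr rfl fun j _ => hterm j,
      sum_sub_distrib, sum_ite_eq', if_pos (by simp)]
  have hle (j : ℕ) (hj : j ∈ range (x + 2)) : j ≤ x + 1 := Nat.lt_succ_iff.mp (mem_range.mp hj)
  rw [jumpMean, tsum_eq_sum (s := range (x + 2)) fun j hj => ?_, ← hsum,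
    ENNReal.ofReal_sum_of_nonneg fun j hj => mul_nonneg (hQ.jumpProb_nonneg x j) (hv j (hle j hj))]
  · exact sum_congr rfl fun j hj => by
      rw [hf j (hle j hj), ENNReal.ofReal_mul (hQ.jumpProb_nonneg x j)]
  · rw [mem_range, not_lt] at hj
    rw [jumpProb, if_neg (by omega), hQ.skip_free x j (by omega)]
    simp

/-- The Laplace transform, at the killing rate `l x`, of the holding time at a state `x < n`;
it vanishes for `n ≤ x` because the process is stopped at `n`. -/
noncomputable def discount (Q : Matrix ℕ ℕ ℝ) (l : ℕ → ℝ) (n : ℕ) : ℕ → ℝ≥0∞ :=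
  (Set.Iio n).indicator fun x => ENNReal.ofReal (-Q x x / (l x + -Q x x))

lemma discount_mul_jumpMean_harmonicFun (hQ : IsSkipFreeGenerator Q) {l : ℕ → ℝ}
    (hl : ∀ i, 0 ≤ l i) (n x : ℕ) :
    discount Q l n x *
        jumpMean Q ((Set.Iic n).indicator fun j => ENNReal.ofReal (harmonicFun Q l j)) x =
      (Set.Iio n).indicator (fun j => ENNReal.ofReal (harmonicFun Q l j)) x := by
  by_cases hx : x < n
  · have hrate : 0 < -Q x x := neg_pos.mpr (hQ.diag_neg x)
    have hmean := jumpMean_eq_ofReal hQ (x := x)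
      (f := (Set.Iic n).indicator fun j => ENNReal.ofReal (harmonicFun Q l j))
      (fun j _ => zero_le_one.trans (one_le_harmonicFun hQ hl j))
      (fun j hj => Set.indicator_of_mem (Set.mem_Iic.mpr (hj.trans hx)) _)
    rw [hmean, isHarmonicFrom_harmonicFun hQ l x x.zero_le, discount,
      Set.indicator_of_mem (Set.mem_Iio.mpr hx), Set.indicator_of_mem (Set.mem_Iio.mpr hx),
      ← ENNReal.ofReal_mul (div_nonneg hrate.le (add_nonneg (hl x) hrate.le))]
    have hkill : l x + -Q x x ≠ 0 := (add_pos_of_nonneg_of_pos (hl x) hrate).ne'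
    congr 1
    have hdiag := (hQ.diag_neg x).ne
    field_simp
    ring
  · simp [discount, hx]

lemma discount_le_one (hQ : IsSkipFreeGenerator Q) {l : ℕ → ℝ} (hl : ∀ i, 0 ≤ l i) (n x : ℕ) :
    discount Q l n x ≤ 1 := by
  have hrate : 0 < -Q x x := neg_pos.mpr (hQ.diag_neg x)
  refine Set.indicator_apply_le' (fun _ => ENNReal.ofReal_le_one.mpr ?_) fun _ => zero_le
  exact (div_le_one (add_pos_of_nonneg_of_pos (hl x) hrate)).mpr (le_add_of_nonneg_left (hl x))

-- Killing at the exit rates makes one jump double the harmonic function: a geometric drift.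
lemma jumpMean_const_sub_harmonicFun (hQ : IsSkipFreeGenerator Q) {C : ℝ} {x : ℕ}
    (hC : ∀ j ≤ x + 1, harmonicFun Q (fun i => -Q i i) j ≤ C) :
    jumpMean Q (fun j => ENNReal.ofReal (C - harmonicFun Q (fun i => -Q i i) j)) x =
      ENNReal.ofReal (C - 2 * harmonicFun Q (fun i => -Q i i) x) := by
  have hharm := isHarmonicFrom_harmonicFun hQ (fun i => -Q i i) x x.zero_le
  rw [jumpMean_eq_ofReal hQ (fun j hj => sub_nonneg.mpr (hC j hj)) fun _ _ => rfl]
  congr 1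
  rw [div_eq_iff (neg_ne_zero.mpr (hQ.diag_neg x).ne)]
  simp only [mul_sub, sum_sub_distrib, ← sum_mul, hQ.row_sum, hharm]
  ring

lemma exists_discount_mul_jumpMean_le (hQ : IsSkipFreeGenerator Q) {l : ℕ → ℝ}
    (hl : ∀ i, 0 ≤ l i) (n : ℕ) :
    ∃ (ρ : ℝ≥0∞) (f : ℕ → ℝ≥0∞), ρ < 1 ∧ (∀ x, f x ≠ ∞) ∧ (∀ x ≤ n, 1 ≤ f x) ∧
      ∀ x, discount Q l n x * jumpMean Q f x ≤ ρ * f x := by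
  have hrates (i : ℕ) : 0 ≤ -Q i i := (neg_pos.mpr (hQ.diag_neg i)).le
  set v := harmonicFun Q fun i => -Q i i
  have hv1 (i : ℕ) : 1 ≤ v i := one_le_harmonicFun hQ hrates i
  set C := v n + 1
  have hC : 0 < C := by linarith [hv1 n]
  have hCv (j : ℕ) (hj : j ≤ n) : v j + 1 ≤ C :=
    add_le_add_left (monotone_harmonicFun hQ hrates hj) 1
  refine ⟨ENNReal.ofReal (1 - 1 / C), fun x => ENNReal.ofReal (C - v x), ?_,
    fun _ => ENNReal.ofReal_ne_top,
    fun x hx => ENNReal.one_le_ofReal.mpr (by linarith [hCv x hx]), fun x => ?_⟩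
  · rw [ENNReal.ofReal_lt_one]
    linarith [one_div_pos.mpr hC]
  by_cases hx : x < n
  · have hratio : C - 2 * v x ≤ (1 - 1 / C) * (C - v x) := by
      have : (C - v x) / C ≤ 1 := (div_le_one hC).mpr (by linarith [hv1 x])
      linarith [hv1 x, show (1 - 1 / C) * (C - v x) = C - v x - (C - v x) / C by ring]
    rw [jumpMean_const_sub_harmonicFun hQ fun j hj => by linarith [hCv j (hj.trans hx)],
      ← ENNReal.ofReal_mul (sub_nonneg.mpr ((div_le_one hC).mpr (by linarith [hv1 n])))]
    exact (mul_le_of_le_one_left' (discount_le_one hQ hl n x)).trans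
      (ENNReal.ofReal_le_ofReal hratio)
  · simp [discount, hx]

end JumpMean

section EmbeddedChain

variable {Ω : Type*} [MeasurableSpace Ω] {μ : Measure Ω} {Q : Matrix ℕ ℕ ℝ} {x₀ : ℕ}
  {X : ℝ≥0 → Ω → ℕ} {Y : ℕ → Ω → ℕ} {H : ℕ → Ω → ℝ≥0}

/-- The event that the first `m + 1` states of the chain `Y` are `y 0, …, y m`. -/
def pathEvent (Y : ℕ → Ω → ℕ) (m : ℕ) (y : ℕ → ℕ) : Set Ω :=
  {ω | ∀ k ≤ m, Y k ω = y k}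

lemma measurableSet_pathEvent (hY : ∀ k, Measurable (Y k)) (m : ℕ) (y : ℕ → ℕ) :
    MeasurableSet (pathEvent Y m y) := by
  have : pathEvent Y m y = ⋂ k ∈ range (m + 1), Y k ⁻¹' {y k} := by
    ext; simp [pathEvent]
  rw [this]
  exact measurableSet_biInter _ fun k _ => hY k (measurableSet_singleton _)

lemma lintegral_congr_pathEvent (hY : ∀ k, Measurable (Y k)) (m : ℕ) {f g : Ω → ℝ≥0∞}
    (h : ∀ y, ∫⁻ ω in pathEvent Y m y, f ω ∂μ = ∫⁻ ω in pathEvent Y m y, g ω ∂μ) :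
    ∫⁻ ω, f ω ∂μ = ∫⁻ ω, g ω ∂μ := by
  let extend (y : Fin (m + 1) → ℕ) (k : ℕ) : ℕ := y (Fin.ofNat (m + 1) k)
  have hmem (ω : Ω) (y : Fin (m + 1) → ℕ) :
      ω ∈ pathEvent Y m (extend y) ↔ (fun k : Fin (m + 1) => Y k ω) = y := by
    refine ⟨fun hω => funext fun k => ?_, fun hω k hk => ?_⟩
    · simpa [extend] using hω k (Nat.lt_succ_iff.mp k.2)
    · simp [extend, ← hω, Nat.mod_eq_of_lt (Nat.lt_succ_iff.mpr hk)]
  have hunion : ⋃ y, pathEvent Y m (extend y) = Set.univ :=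
    Set.eq_univ_of_forall fun ω => Set.mem_iUnion.mpr ⟨_, (hmem ω _).mpr rfl⟩
  have hdisj : Pairwise (Function.onFun Disjoint fun y => pathEvent Y m (extend y)) :=
    fun y y' hne => Set.disjoint_left.mpr fun ω hω hω' =>
      hne (((hmem ω y).mp hω).symm.trans ((hmem ω y').mp hω'))
  have hmeas := fun y => measurableSet_pathEvent hY m (extend y)
  rw [← setLIntegral_univ f, ← setLIntegral_univ g, ← hunion, lintegral_iUnion hmeas hdisj,
    lintegral_iUnion hmeas hdisj]
  exact tsum_congr fun y => h (extend y)

/-- The product of the weights `g` of the first `m` states of the chain `Y`. -/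
noncomputable def chainWeight (g : ℕ → ℝ≥0∞) (Y : ℕ → Ω → ℕ) (m : ℕ) (ω : Ω) : ℝ≥0∞ :=
  ∏ k ∈ range m, g (Y k ω)

lemma measurable_chainWeight (hY : ∀ k, Measurable (Y k)) (g : ℕ → ℝ≥0∞) (m : ℕ) :
    Measurable (chainWeight g Y m) :=
  Finset.measurable_fun_prod _ fun k _ => (measurable_of_countable g).comp (hY k)

namespace IsJumpDescription

lemma ae_state_zero [IsProbabilityMeasure μ] (hJ : IsJumpDescription μ Q x₀ X Y H) :
    ∀ᵐ ω ∂μ, Y 0 ω = x₀ := by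
  have h := hJ.jump_chain 0 fun _ => x₀
  simp only [nonpos_iff_eq_zero, forall_eq, if_true, range_zero, prod_empty, mul_one,
    ENNReal.ofReal_one] at h
  exact (prob_compl_eq_zero_iff (hJ.measurable_state 0 (measurableSet_singleton x₀))).mpr h

lemma measure_pathEvent_inter (hQ : IsSkipFreeGenerator Q) (hJ : IsJumpDescription μ Q x₀ X Y H)
    (m : ℕ) (y : ℕ → ℕ) (z : ℕ) :
    μ (Y (m + 1) ⁻¹' {z} ∩ pathEvent Y m y) =
      μ (pathEvent Y m y) * ENNReal.ofReal (jumpProb Q (y m) z) := by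
  set y' := Function.update y (m + 1) z
  have hy' (k : ℕ) (hk : k ≤ m) : y' k = y k := Function.update_of_ne (by omega) _ _
  have hz : y' (m + 1) = z := Function.update_self _ _ _
  have hset : Y (m + 1) ⁻¹' {z} ∩ pathEvent Y m y = pathEvent Y (m + 1) y' := by
    ext ω
    refine ⟨fun ⟨hω, hpath⟩ k hk => ?_, fun hω => ⟨(hω _ le_rfl).trans hz, fun k hk =>
      (hω k (hk.trans m.le_succ)).trans (hy' k hk)⟩⟩
    rcases Nat.le_succ_iff.mp hk with hk | rfl
    · rw [hy' k hk, hpath k hk]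
    · exact hω.trans hz.symm
  have hprod : ∏ k ∈ range m, jumpProb Q (y' k) (y' (k + 1)) =
      ∏ k ∈ range m, jumpProb Q (y k) (y (k + 1)) :=
    prod_congr rfl fun k hk => by rw [hy' k (mem_range.mp hk).le, hy' (k + 1) (mem_range.mp hk)]
  have hnonneg : 0 ≤ (if y 0 = x₀ then (1 : ℝ) else 0) *
      ∏ k ∈ range m, jumpProb Q (y k) (y (k + 1)) :=
    mul_nonneg (by positivity) (prod_nonneg fun k _ => hQ.jumpProb_nonneg _ _)
  rw [hset, pathEvent, pathEvent, hJ.jump_chain, hJ.jump_chain, ← ENNReal.ofReal_mul hnonneg,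
    prod_range_succ, hprod, hy' 0 m.zero_le, hy' m le_rfl, hz, mul_assoc]

lemma setLIntegral_next_state (hQ : IsSkipFreeGenerator Q) (hJ : IsJumpDescription μ Q x₀ X Y H)
    (f : ℕ → ℝ≥0∞) (m : ℕ) (y : ℕ → ℕ) :
    ∫⁻ ω in pathEvent Y m y, f (Y (m + 1) ω) ∂μ = μ (pathEvent Y m y) * jumpMean Q f (y m) := by
  have hY := hJ.measurable_state (m + 1)
  rw [← lintegral_map (measurable_of_countable f) hY, lintegral_countable', jumpMean,
    ← ENNReal.tsum_mul_left]
  refine tsum_congr fun z => ?_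
  have hz := measurableSet_singleton z
  rw [Measure.map_apply hY hz, Measure.restrict_apply (hY hz), hJ.measure_pathEvent_inter hQ]
  ring

lemma lintegral_chainWeight_succ (hQ : IsSkipFreeGenerator Q)
    (hJ : IsJumpDescription μ Q x₀ X Y H) (g f : ℕ → ℝ≥0∞) (m : ℕ) :
    ∫⁻ ω, chainWeight g Y (m + 1) ω * f (Y (m + 1) ω) ∂μ =
      ∫⁻ ω, chainWeight g Y m ω * (g (Y m ω) * jumpMean Q f (Y m ω)) ∂μ := by
  refine lintegral_congr_pathEvent hJ.measurable_state m fun y => ?_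
  have hC := measurableSet_pathEvent hJ.measurable_state m y
  have hf : Measurable fun ω => f (Y (m + 1) ω) :=
    (measurable_of_countable f).comp (hJ.measurable_state _)
  have hweight (ω : Ω) (hω : ω ∈ pathEvent Y m y) :
      chainWeight g Y m ω = ∏ k ∈ range m, g (y k) :=
    prod_congr rfl fun k hk => by rw [hω k (mem_range.mp hk).le]
  calc ∫⁻ ω in pathEvent Y m y, chainWeight g Y (m + 1) ω * f (Y (m + 1) ω) ∂μ
      = ∫⁻ ω in pathEvent Y m y, (∏ k ∈ range m, g (y k)) * g (y m) * f (Y (m + 1) ω) ∂μ :=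
        setLIntegral_congr_fun hC fun ω hω => by
          simp only [chainWeight, prod_range_succ, ← hweight ω hω, ← hω m le_rfl]
    _ = (∏ k ∈ range m, g (y k)) * (g (y m) * jumpMean Q f (y m)) * μ (pathEvent Y m y) := by
        rw [lintegral_const_mul _ hf, hJ.setLIntegral_next_state hQ]
        ring
    _ = ∫⁻ ω in pathEvent Y m y, chainWeight g Y m ω * (g (Y m ω) * jumpMean Q f (Y m ω)) ∂μ := by
        rw [← setLIntegral_const]
        exact setLIntegral_congr_fun hC fun ω hω => by
          simp only [hweight ω hω, hω m le_rfl]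

end IsJumpDescription

end EmbeddedChain

section ReachingN

variable {Ω : Type*} [MeasurableSpace Ω] {μ : Measure Ω} [IsProbabilityMeasure μ]
  {Q : Matrix ℕ ℕ ℝ} {x₀ : ℕ} {X : ℝ≥0 → Ω → ℕ} {Y : ℕ → Ω → ℕ} {H : ℕ → Ω → ℝ≥0}
  {l : ℕ → ℝ} {n : ℕ}

namespace IsJumpDescription

lemma lintegral_state_zero (hJ : IsJumpDescription μ Q x₀ X Y H) (f : ℕ → ℝ≥0∞) :
    ∫⁻ ω, f (Y 0 ω) ∂μ = f x₀ := by
  have hzero : (fun ω => f (Y 0 ω)) =ᵐ[μ] fun _ => f x₀ := hJ.ae_state_zero.mono fun ω hω => by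
    simp only [hω]
  rw [lintegral_congr_ae hzero, lintegral_const, measure_univ, mul_one]

lemma lintegral_chainWeight_le_pow (hQ : IsSkipFreeGenerator Q)
    (hJ : IsJumpDescription μ Q x₀ X Y H) {g f : ℕ → ℝ≥0∞} {ρ : ℝ≥0∞}
    (h : ∀ x, g x * jumpMean Q f x ≤ ρ * f x) (m : ℕ) :
    ∫⁻ ω, chainWeight g Y m ω * f (Y m ω) ∂μ ≤ ρ ^ m * f x₀ := by
  induction m with
  | zero => simp [chainWeight, hJ.lintegral_state_zero f]
  | succ m ih =>
    have hmeas : Measurable fun ω => chainWeight g Y m ω * f (Y m ω) :=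
      (measurable_chainWeight hJ.measurable_state g m).mul
        ((measurable_of_countable f).comp (hJ.measurable_state m))
    calc ∫⁻ ω, chainWeight g Y (m + 1) ω * f (Y (m + 1) ω) ∂μ
        = ∫⁻ ω, chainWeight g Y m ω * (g (Y m ω) * jumpMean Q f (Y m ω)) ∂μ :=
          hJ.lintegral_chainWeight_succ hQ g f m
      _ ≤ ∫⁻ ω, ρ * (chainWeight g Y m ω * f (Y m ω)) ∂μ := lintegral_mono fun ω => by
          rw [mul_left_comm ρ]
          exact mul_le_mul_right (h (Y m ω)) _
      _ ≤ ρ ^ (m + 1) * f x₀ := by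
          rw [lintegral_const_mul _ hmeas, pow_succ', mul_assoc]
          exact mul_le_mul_right ih ρ

lemma tendsto_lintegral_chainWeight_discount (hQ : IsSkipFreeGenerator Q)
    (hJ : IsJumpDescription μ Q x₀ X Y H) (hl : ∀ i, 0 ≤ l i) (n : ℕ) :
    Tendsto (fun m => ∫⁻ ω, chainWeight (discount Q l n) Y m ω *
      (Set.Iic n).indicator (fun j => ENNReal.ofReal (harmonicFun Q l j)) (Y m ω) ∂μ)
      atTop (𝓝 0) := by
  obtain ⟨ρ, f, hρ, hf, hf1, hdrift⟩ := exists_discount_mul_jumpMean_le hQ hl n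
  set c := ENNReal.ofReal (harmonicFun Q l n)
  have hle (x : ℕ) :
      (Set.Iic n).indicator (fun j => ENNReal.ofReal (harmonicFun Q l j)) x ≤ c * f x := by
    refine Set.indicator_apply_le' (fun hx => ?_) fun _ => zero_le
    calc ENNReal.ofReal (harmonicFun Q l x)
        ≤ c := ENNReal.ofReal_le_ofReal (monotone_harmonicFun hQ hl hx)
      _ ≤ c * f x := le_mul_of_one_le_right' (hf1 x hx)
  have hgeom : Tendsto (fun m => c * (ρ ^ m * f x₀)) atTop (𝓝 0) := by
    have := ENNReal.Tendsto.const_mul (a := c) (ENNReal.Tendsto.mul_const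
      (ENNReal.tendsto_pow_atTop_nhds_zero_of_lt_one hρ) (Or.inr (hf x₀)))
      (Or.inr ENNReal.ofReal_ne_top)
    simpa using this
  refine tendsto_of_tendsto_of_tendsto_of_le_of_le tendsto_const_nhds hgeom (fun _ => zero_le)
    fun m => ?_
  calc _ ≤ ∫⁻ ω, c * (chainWeight (discount Q l n) Y m ω * f (Y m ω)) ∂μ :=
        lintegral_mono fun ω => by
          rw [mul_left_comm c]
          exact mul_le_mul_right (hle (Y m ω)) _
    _ ≤ c * (ρ ^ m * f x₀) := by
        rw [lintegral_const_mul' _ _ ENNReal.ofReal_ne_top]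
        exact mul_le_mul_right (hJ.lintegral_chainWeight_le_pow hQ hdrift m) c

-- Optional stopping for the martingale `chainWeight (discount Q l n) Y m * harmonicFun Q l (Y m)`.
lemma mul_sum_add_lintegral_chainWeight (hQ : IsSkipFreeGenerator Q)
    (hJ : IsJumpDescription μ Q 0 X Y H) (hl : ∀ i, 0 ≤ l i) (n m : ℕ) :
    ENNReal.ofReal (harmonicFun Q l n) * ∑ k ∈ range m,
        ∫⁻ ω, chainWeight (discount Q l n) Y k ω * Set.indicator {n} 1 (Y k ω) ∂μ +
      ∫⁻ ω, chainWeight (discount Q l n) Y m ω *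
        (Set.Iic n).indicator (fun j => ENNReal.ofReal (harmonicFun Q l j)) (Y m ω) ∂μ = 1 := by
  have hmeas (m : ℕ) (f : ℕ → ℝ≥0∞) :
      Measurable fun ω => chainWeight (discount Q l n) Y m ω * f (Y m ω) :=
    (measurable_chainWeight hJ.measurable_state _ m).mul
      ((measurable_of_countable f).comp (hJ.measurable_state m))
  have hsplit (x : ℕ) :
      (Set.Iic n).indicator (fun j => ENNReal.ofReal (harmonicFun Q l j)) x =
        ENNReal.ofReal (harmonicFun Q l n) * Set.indicator {n} 1 x +
          (Set.Iio n).indicator (fun j => ENNReal.ofReal (harmonicFun Q l j)) x := by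
    rcases lt_trichotomy x n with hx | rfl | hx
    · simp [hx, hx.le, hx.ne]
    · simp
    · simp [hx.le, hx.not_ge, hx.ne']
  induction m with
  | zero => simp [chainWeight, hJ.lintegral_state_zero, harmonicFun_zero]
  | succ m ih =>
    rw [← ih, hJ.lintegral_chainWeight_succ hQ]
    simp only [discount_mul_jumpMean_harmonicFun hQ hl, hsplit, mul_add (chainWeight _ _ _ _)]
    rw [lintegral_add_left (hmeas m fun x => ENNReal.ofReal (harmonicFun Q l n) *
      Set.indicator {n} 1 x), sum_range_succ, mul_add, add_assoc]
    simp only [mul_left_comm _ (ENNReal.ofReal (harmonicFun Q l n)),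
      lintegral_const_mul _ (hmeas m _)]

lemma tsum_lintegral_chainWeight_discount (hQ : IsSkipFreeGenerator Q)
    (hJ : IsJumpDescription μ Q 0 X Y H) (hl : ∀ i, 0 ≤ l i) (n : ℕ) :
    ∑' m, ∫⁻ ω, chainWeight (discount Q l n) Y m ω * Set.indicator {n} 1 (Y m ω) ∂μ =
      (ENNReal.ofReal (harmonicFun Q l n))⁻¹ := by
  set a : ℕ → ℝ≥0∞ := fun m =>
    ∫⁻ ω, chainWeight (discount Q l n) Y m ω * Set.indicator {n} 1 (Y m ω) ∂μ
  have hlim := (ENNReal.Tendsto.const_mul (a := ENNReal.ofReal (harmonicFun Q l n))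
    (ENNReal.tendsto_nat_tsum a) (Or.inr ENNReal.ofReal_ne_top)).add
    (hJ.tendsto_lintegral_chainWeight_discount hQ hl n)
  simp only [a, hJ.mul_sum_add_lintegral_chainWeight hQ hl n, add_zero] at hlim
  exact ENNReal.eq_inv_of_mul_eq_one_left
    ((mul_comm _ _).trans (tendsto_nhds_unique hlim tendsto_const_nhds))

end IsJumpDescription

end ReachingN

section HoldingTimes

variable {Ω : Type*} [MeasurableSpace Ω] {μ : Measure Ω} [IsProbabilityMeasure μ]
  {Q : Matrix ℕ ℕ ℝ} {x₀ : ℕ} {X : ℝ≥0 → Ω → ℕ} {Y : ℕ → Ω → ℕ} {H : ℕ → Ω → ℝ≥0}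

namespace IsJumpDescription

lemma ae_holding_pos (hJ : IsJumpDescription μ Q x₀ X Y H) : ∀ᵐ ω ∂μ, ∀ k, 0 < H k ω := by
  refine ae_all_iff.mpr fun m => ?_
  have hpos : MeasurableSet {ω | 0 < H m ω} :=
    measurableSet_lt measurable_const (hJ.measurable_holding m)
  have hprob : μ {ω | 0 < H m ω} = 1 := by
    rw [← lintegral_indicator_one hpos, ← measure_univ (μ := μ), ← lintegral_one]
    refine lintegral_congr_pathEvent hJ.measurable_state m fun y => ?_
    have hhold := hJ.holding m y 0
    simp only [Pi.zero_apply, NNReal.coe_zero, mul_zero, Real.exp_zero, ENNReal.ofReal_one,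
      prod_const_one, mul_one] at hhold
    rw [lintegral_indicator_one hpos, Measure.restrict_apply hpos, setLIntegral_one]
    exact le_antisymm (measure_mono Set.inter_subset_right)
      (hhold.ge.trans (measure_mono fun ω hω => ⟨hω.2 m le_rfl, hω.1⟩))
  exact (prob_compl_eq_zero_iff hpos).mpr hprob

lemma map_holding (hQ : IsSkipFreeGenerator Q) (hJ : IsJumpDescription μ Q x₀ X Y H) (m : ℕ)
    (y : ℕ → ℕ) :
    (μ.restrict (pathEvent Y m y)).map (fun ω (k : Fin (m + 1)) => (H k ω : ℝ)) =
      μ (pathEvent Y m y) • Measure.pi fun k : Fin (m + 1) => expMeasure (-Q (y k) (y k)) := by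
  have hmeas : Measurable fun ω (k : Fin (m + 1)) => (H k ω : ℝ) :=
    measurable_pi_lambda _ fun k => (hJ.measurable_holding k).coe_nnreal_real
  have hrate (k : Fin (m + 1)) : 0 < -Q (y k) (y k) := neg_pos.mpr (hQ.diag_neg _)
  have huniv : (μ.restrict (pathEvent Y m y)).map (fun ω (k : Fin (m + 1)) => (H k ω : ℝ))
      Set.univ = μ (pathEvent Y m y) := by
    rw [Measure.map_apply hmeas MeasurableSet.univ, Set.preimage_univ, Measure.restrict_apply_univ]
  rw [← huniv]
  refine eq_smul_pi_expMeasure_of_tail hrate fun t => ?_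
  have hbox : MeasurableSet (Set.univ.pi fun k => Set.Ioi (t k)) :=
    MeasurableSet.univ_pi fun _ => measurableSet_Ioi
  have htail : μ ((fun ω (k : Fin (m + 1)) => (H k ω : ℝ)) ⁻¹'
        Set.univ.pi (fun k => Set.Ioi (t k)) ∩ pathEvent Y m y) =
      μ {ω | (∀ k ≤ m, Y k ω = y k) ∧
        ∀ k ≤ m, (t (Fin.ofNat (m + 1) k)).toNNReal < H k ω} := by
    refine measure_congr ?_
    filter_upwards [hJ.ae_holding_pos] with ω hpos
    refine propext (and_comm.trans (and_congr_right fun _ => ?_))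
    simp only [← NNReal.coe_lt_coe, Real.coe_toNNReal', max_lt_iff, NNReal.coe_pos, hpos, and_true]
    refine ⟨fun h k hk => ?_, fun h k _ => ?_⟩
    · simpa [Nat.mod_eq_of_lt (Nat.lt_succ_iff.mpr hk)] using h (Fin.ofNat (m + 1) k) trivial
    · simpa using h k (Nat.lt_succ_iff.mp k.2)
  rw [Measure.map_apply hmeas hbox, Measure.restrict_apply (hmeas hbox), htail,
    hJ.holding, huniv, ← Fin.prod_univ_eq_prod_range
      (fun k => ENNReal.ofReal (Real.exp (Q (y k) (y k) * (t (Fin.ofNat (m + 1) k)).toNNReal)))]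
  congr 1
  refine prod_congr rfl fun k _ => ?_
  rw [expMeasure_Ioi (hrate k), Real.coe_toNNReal', neg_mul, neg_neg]
  simp

lemma setLIntegral_prod_holding (hQ : IsSkipFreeGenerator Q)
    (hJ : IsJumpDescription μ Q x₀ X Y H) {F : ℕ → ℝ → ℝ≥0∞} (hF : ∀ k, Measurable (F k)) (m : ℕ)
    (y : ℕ → ℕ) :
    ∫⁻ ω in pathEvent Y m y, ∏ k ∈ range (m + 1), F k (H k ω) ∂μ =
      μ (pathEvent Y m y) *
        ∏ k ∈ range (m + 1), ∫⁻ h, F k h ∂expMeasure (-Q (y k) (y k)) := by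
  have hrate (k : Fin (m + 1)) : 0 < -Q (y k) (y k) := neg_pos.mpr (hQ.diag_neg _)
  have := fun k => isProbabilityMeasure_expMeasure (hrate k)
  have hmeas : Measurable fun ω (k : Fin (m + 1)) => (H k ω : ℝ) :=
    measurable_pi_lambda _ fun k => (hJ.measurable_holding k).coe_nnreal_real
  have hprod : Measurable fun x : Fin (m + 1) → ℝ => ∏ k, F k.val (x k) :=
    Finset.measurable_fun_prod _ fun k _ => (hF k).comp (measurable_pi_apply k)
  calc ∫⁻ ω in pathEvent Y m y, ∏ k ∈ range (m + 1), F k (H k ω) ∂μ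
      = ∫⁻ ω in pathEvent Y m y, ∏ k : Fin (m + 1), F k.val (H k.val ω) ∂μ := by
        simp only [← Fin.prod_univ_eq_prod_range (fun k => F k (H k _))]
    _ = ∫⁻ x, ∏ k : Fin (m + 1), F k.val (x k)
          ∂(μ (pathEvent Y m y) • Measure.pi fun k : Fin (m + 1) =>
            expMeasure (-Q (y k) (y k))) := by
        rw [← hJ.map_holding hQ, lintegral_map hprod hmeas]
    _ = _ := by
        rw [lintegral_smul_measure, smul_eq_mul, lintegral_pi_prod _ fun k : Fin (m + 1) => hF k,
          Fin.prod_univ_eq_prod_range (fun k => ∫⁻ h, F k h ∂expMeasure (-Q (y k) (y k)))]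

lemma lintegral_prod_holding_mul (hQ : IsSkipFreeGenerator Q)
    (hJ : IsJumpDescription μ Q x₀ X Y H) {G : ℕ → ℝ → ℝ≥0∞} (hG : ∀ x, Measurable (G x))
    (f : ℕ → ℝ≥0∞) (m : ℕ) :
    ∫⁻ ω, (∏ k ∈ range m, G (Y k ω) (H k ω)) * f (Y m ω) ∂μ =
      ∫⁻ ω, chainWeight (fun x => ∫⁻ h, G x h ∂expMeasure (-Q x x)) Y m ω * f (Y m ω) ∂μ := by
  refine lintegral_congr_pathEvent hJ.measurable_state m fun y => ?_
  have hC := measurableSet_pathEvent hJ.measurable_state m y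
  let F : ℕ → ℝ → ℝ≥0∞ := Function.update (fun k => G (y k)) m fun _ => f (y m)
  have hF (k : ℕ) : Measurable (F k) := by
    rcases eq_or_ne k m with rfl | hk
    · simp only [F, Function.update_self, measurable_const]
    · simpa only [F, Function.update_of_ne hk] using hG (y k)
  have hFm : F m = fun _ => f (y m) := Function.update_self _ _ _
  have hFk (k : ℕ) (hk : k ∈ range m) : F k = G (y k) :=
    Function.update_of_ne (mem_range.mp hk).ne _ _
  have := isProbabilityMeasure_expMeasure (neg_pos.mpr (hQ.diag_neg (y m)))
  calc ∫⁻ ω in pathEvent Y m y, (∏ k ∈ range m, G (Y k ω) (H k ω)) * f (Y m ω) ∂μ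
      = ∫⁻ ω in pathEvent Y m y, ∏ k ∈ range (m + 1), F k (H k ω) ∂μ :=
        setLIntegral_congr_fun hC fun ω hω => by
          simp only [prod_range_succ, hFm, hω m le_rfl]
          congr 1
          exact prod_congr rfl fun k hk => by rw [hFk k hk, hω k (mem_range.mp hk).le]
    _ = (∏ k ∈ range m, ∫⁻ h, G (y k) h ∂expMeasure (-Q (y k) (y k))) * f (y m) *
          μ (pathEvent Y m y) := by
        rw [hJ.setLIntegral_prod_holding hQ hF, prod_range_succ, hFm, lintegral_const,
          measure_univ, mul_one, mul_comm,
          prod_congr rfl fun k hk => by rw [hFk k hk]]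
    _ = _ := by
        rw [← setLIntegral_const]
        refine setLIntegral_congr_fun hC fun ω hω => ?_
        simp only [chainWeight, hω m le_rfl]
        congr 1
        exact prod_congr rfl fun k hk => by rw [hω k (mem_range.mp hk).le]

end IsJumpDescription

end HoldingTimes

section Trajectory

variable {Ω : Type*} {X : ℝ≥0 → Ω → ℕ} {Y : ℕ → Ω → ℕ} {H : ℕ → Ω → ℝ≥0} {n m i : ℕ} {ω : Ω}

/-- `m` is the index of the first visit of the chain `Y` to `[n, ∞)`, and that visit is to `n`. For
a skip-free chain started below `n` this is the first visit to `n`. -/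
def HitsAt (n : ℕ) (Y : ℕ → Ω → ℕ) (m : ℕ) (ω : Ω) : Prop :=
  Y m ω = n ∧ ∀ k < m, Y k ω < n

lemma measurableSet_exists_hitsAt [MeasurableSpace Ω] (hY : ∀ k, Measurable (Y k)) (n : ℕ) :
    MeasurableSet {ω | ∃ m, HitsAt n Y m ω} := by
  have hunion : {ω | ∃ m, HitsAt n Y m ω} =
      ⋃ m, (Y m ⁻¹' {n} ∩ ⋂ k ∈ range m, Y k ⁻¹' Set.Iio n) := by
    ext; simp [HitsAt]
  rw [hunion]
  exact MeasurableSet.iUnion fun m => (hY m (measurableSet_singleton n)).inter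
    (measurableSet_biInter _ fun k _ => hY k measurableSet_Iio)

/-- The trajectory `t ↦ X t ω` passes through the states `Y 0 ω, Y 1 ω, …` and stays in them for
the positive times `H 0 ω, H 1 ω, …`. -/
structure FollowsJumps (X : ℝ≥0 → Ω → ℕ) (Y : ℕ → Ω → ℕ) (H : ℕ → Ω → ℝ≥0) (ω : Ω) : Prop where
  holding_pos : ∀ k, 0 < H k ω
  eq_state : ∀ (k : ℕ) (t : ℝ≥0),
    transitionTime H k ω ≤ t → t < transitionTime H (k + 1) ω → X t ω = Y k ω

lemma transitionTime_succ (k : ℕ) (ω : Ω) :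
    transitionTime H (k + 1) ω = transitionTime H k ω + H k ω :=
  sum_range_succ _ _

lemma monotone_transitionTime (ω : Ω) : Monotone fun k => transitionTime H k ω :=
  monotone_nat_of_le_succ fun k => by rw [transitionTime_succ]; exact le_self_add

lemma exists_mem_Ico_transitionTime {t : ℝ≥0} (h : t < transitionTime H m ω) :
    ∃ k < m, transitionTime H k ω ≤ t ∧ t < transitionTime H (k + 1) ω := by
  induction m with
  | zero => simp [transitionTime] at h
  | succ m ih =>
    rcases lt_or_ge t (transitionTime H m ω) with hlt | hge
    · obtain ⟨k, hk, hkt⟩ := ih hlt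
      exact ⟨k, hk.trans m.lt_succ_self, hkt⟩
    · exact ⟨m, m.lt_succ_self, hge, h⟩

namespace FollowsJumps

lemma hittingAfter_eq_transitionTime (hX : FollowsJumps X Y H ω) (hm : HitsAt n Y m ω) :
    hittingAfter X {n} 0 ω = (transitionTime H m ω : WithTop ℝ≥0) := by
  have hhit : X (transitionTime H m ω) ω = n := by
    rw [hX.eq_state m _ le_rfl, hm.1]
    rw [transitionTime_succ]
    exact lt_add_of_pos_right _ (hX.holding_pos m)
  rw [hittingAfter, if_pos ⟨_, zero_le, hhit⟩]
  congr 1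
  refine IsLeast.csInf_eq ⟨⟨zero_le, hhit⟩, fun t ht => not_lt.mp fun hlt => ?_⟩
  obtain ⟨k, hk, hle, hlt⟩ := exists_mem_Ico_transitionTime hlt
  exact (hm.2 k hk).ne ((hX.eq_state k t hle hlt).symm.trans ht.2)

lemma image_setOf_state_eq (hX : FollowsJumps X Y H ω) (hm : HitsAt n Y m ω) :
    (fun t : ℝ≥0 => (t : ℝ)) '' {t | X t ω = i ∧ (t : WithTop ℝ≥0) < hittingAfter X {n} 0 ω} =
      ⋃ k ∈ (range m).filter fun k => Y k ω = i,
        Set.Ico (transitionTime H k ω : ℝ) (transitionTime H (k + 1) ω) := by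
  rw [hX.hittingAfter_eq_transitionTime hm]
  ext x
  simp only [Set.mem_image, Set.mem_ofPred_eq, WithTop.coe_lt_coe, Set.mem_iUnion, mem_filter,
    mem_range, Set.mem_Ico, exists_prop]
  constructor
  · rintro ⟨t, ⟨hi, ht⟩, rfl⟩
    obtain ⟨k, hk, hle, hlt⟩ := exists_mem_Ico_transitionTime ht
    exact ⟨k, ⟨hk, (hX.eq_state k t hle hlt).symm.trans hi⟩, NNReal.coe_le_coe.mpr hle,
      NNReal.coe_lt_coe.mpr hlt⟩
  · rintro ⟨k, ⟨hk, hi⟩, hle, hlt⟩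
    lift x to ℝ≥0 using (transitionTime H k ω).2.trans hle
    rw [NNReal.coe_le_coe] at hle
    rw [NNReal.coe_lt_coe] at hlt
    exact ⟨x, ⟨(hX.eq_state k x hle hlt).trans hi, hlt.trans_le (monotone_transitionTime ω hk)⟩,
      rfl⟩

lemma occupationTime_eq_sum (hX : FollowsJumps X Y H ω) (hm : HitsAt n Y m ω) (i : ℕ) :
    occupationTime X n i ω = ∑ k ∈ range m, if Y k ω = i then (H k ω : ℝ≥0∞) else 0 := by
  have hmono : Monotone fun k => (transitionTime H k ω : ℝ) := fun a b hab =>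
    NNReal.coe_le_coe.mpr (monotone_transitionTime ω hab)
  have hdisj : Pairwise (Function.onFun Disjoint fun k =>
      Set.Ico (transitionTime H k ω : ℝ) (transitionTime H (k + 1) ω)) :=
    hmono.pairwise_disjoint_on_Ico_succ
  rw [occupationTime, hX.image_setOf_state_eq hm,
    measure_biUnion_finset (fun a _ b _ hab => hdisj hab) fun _ _ => measurableSet_Ico, sum_filter]
  refine sum_congr rfl fun k _ => ?_
  rw [Real.volume_Ico, transitionTime_succ, NNReal.coe_add, add_sub_cancel_left,
    ENNReal.ofReal_coe_nnreal]

lemma occupationTime_ne_top (hX : FollowsJumps X Y H ω) (hm : HitsAt n Y m ω) (i : ℕ) :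
    occupationTime X n i ω ≠ ∞ := by
  rw [hX.occupationTime_eq_sum hm]
  exact ENNReal.sum_ne_top.mpr fun k _ => by split_ifs <;> simp

lemma occupationTime_eq_tsum (hX : FollowsJumps X Y H ω) (hm : HitsAt n Y m ω) (i : ℕ) :
    occupationTime X n i ω =
      ∑' k, if Y k ω = i ∧ ∀ j ≤ k, Y j ω < n then (H k ω : ℝ≥0∞) else 0 := by
  rw [hX.occupationTime_eq_sum hm, tsum_eq_sum (s := range m) fun k hk => if_neg fun h =>
    (h.2 m (not_lt.mp (mt mem_range.mpr hk))).ne hm.1]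
  refine sum_congr rfl fun k hk => ?_
  have hbelow : ∀ j ≤ k, Y j ω < n := fun j hj => hm.2 j (hj.trans_lt (mem_range.mp hk))
  exact if_congr (and_iff_left hbelow).symm rfl rfl

lemma sum_mul_occupationTime (hX : FollowsJumps X Y H ω) (hm : HitsAt n Y m ω) (l : ℕ → ℝ) :
    ∑ i ∈ range n, l i * (occupationTime X n i ω).toReal =
      ∑ k ∈ range m, l (Y k ω) * H k ω := by
  have hocc (i : ℕ) : (occupationTime X n i ω).toReal =
      ∑ k ∈ range m, if Y k ω = i then (H k ω : ℝ) else 0 := by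
    rw [hX.occupationTime_eq_sum hm, ENNReal.toReal_sum fun k _ => by split_ifs <;> simp]
    exact sum_congr rfl fun k _ => by split_ifs <;> simp
  simp only [hocc, mul_sum, mul_ite, mul_zero]
  rw [sum_comm]
  refine sum_congr rfl fun k hk => ?_
  rw [sum_ite_eq, if_pos (mem_range.mpr (hm.2 k (mem_range.mp hk)))]

end FollowsJumps

end Trajectory

section Killing

variable {Ω : Type*} {X : ℝ≥0 → Ω → ℕ} {Y : ℕ → Ω → ℕ} {H : ℕ → Ω → ℝ≥0} {n m : ℕ} {ω : Ω}

/-- The probability that a process killed at rate `l x` in the state `x` survives a stay of length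
`h` there; it is set to zero for `n ≤ x` because the process is stopped at `n`. -/
noncomputable def survivalWeight (l : ℕ → ℝ) (n x : ℕ) (h : ℝ) : ℝ≥0∞ :=
  (Set.Iio n).indicator (fun x => ENNReal.ofReal (Real.exp (-(l x * h)))) x

/-- The probability that the process killed at the rates `l` survives its first `m` stays, given
its states and holding times, if these stays are below `n`; otherwise zero. -/
noncomputable def survivalProd (l : ℕ → ℝ) (n : ℕ) (Y : ℕ → Ω → ℕ) (H : ℕ → Ω → ℝ≥0) (m : ℕ)
    (ω : Ω) : ℝ≥0∞ :=
  ∏ k ∈ range m, survivalWeight l n (Y k ω) (H k ω)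

lemma measurable_survivalWeight (l : ℕ → ℝ) (n x : ℕ) : Measurable (survivalWeight l n x) := by
  unfold survivalWeight
  by_cases hx : x < n
  · simp only [Set.indicator_of_mem (Set.mem_Iio.mpr hx)]
    fun_prop
  · simp only [Set.indicator_of_notMem (mt Set.mem_Iio.mp hx), measurable_const]

lemma lintegral_survivalWeight {Q : Matrix ℕ ℕ ℝ} (hQ : IsSkipFreeGenerator Q) {l : ℕ → ℝ}
    (hl : ∀ i, 0 ≤ l i) (n x : ℕ) :
    ∫⁻ h, survivalWeight l n x h ∂expMeasure (-Q x x) = discount Q l n x := by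
  by_cases hx : x < n
  · simpa [survivalWeight, discount, hx] using
      lintegral_exp_neg_expMeasure (neg_pos.mpr (hQ.diag_neg x)) (hl x)
  · simp [survivalWeight, discount, hx]

lemma survivalProd_mul_indicator_of_not_hitsAt (l : ℕ → ℝ) (hm : ¬HitsAt n Y m ω) :
    survivalProd l n Y H m ω * Set.indicator {n} 1 (Y m ω) = 0 := by
  by_cases hYm : Y m ω = n
  · obtain ⟨k, hk, hkn⟩ : ∃ k < m, n ≤ Y k ω := by
      by_contra! hlt
      exact hm ⟨hYm, hlt⟩
    rw [survivalProd, prod_eq_zero (mem_range.mpr hk), zero_mul]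
    exact Set.indicator_of_notMem (by simpa using hkn) _
  · rw [Set.indicator_of_notMem (by simpa using hYm), mul_zero]

lemma tsum_survivalProd_of_hitsAt (l : ℕ → ℝ) (hm : HitsAt n Y m ω) :
    ∑' k, survivalProd l n Y H k ω * Set.indicator {n} 1 (Y k ω) =
      ENNReal.ofReal (Real.exp (-∑ k ∈ range m, l (Y k ω) * H k ω)) := by
  have hunique (k : ℕ) (hk : k ≠ m) : ¬HitsAt n Y k ω := fun hit => by
    rcases hk.lt_or_gt with hlt | hgt
    · exact (hm.2 k hlt).ne hit.1
    · exact (hit.2 m hgt).ne hm.1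
  rw [tsum_eq_single m fun k hk => survivalProd_mul_indicator_of_not_hitsAt l (hunique k hk), hm.1,
    Set.indicator_of_mem (Set.mem_singleton n), Pi.one_apply, mul_one, ← sum_neg_distrib,
    Real.exp_sum, ENNReal.ofReal_prod_of_nonneg fun _ _ => (Real.exp_pos _).le]
  exact prod_congr rfl fun k hk =>
    Set.indicator_of_mem (Set.mem_Iio.mpr (hm.2 k (mem_range.mp hk))) _

end Killing

section OccupationTime

variable {Ω : Type*} [MeasurableSpace Ω] {μ : Measure Ω} [IsProbabilityMeasure μ]
  {Q : Matrix ℕ ℕ ℝ} {X : ℝ≥0 → Ω → ℕ} {Y : ℕ → Ω → ℕ} {H : ℕ → Ω → ℝ≥0}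

namespace IsJumpDescription

lemma ae_followsJumps {x₀ : ℕ} (hJ : IsJumpDescription μ Q x₀ X Y H) :
    ∀ᵐ ω ∂μ, FollowsJumps X Y H ω := by
  filter_upwards [hJ.ae_holding_pos, hJ.path] with ω hpos hpath using ⟨hpos, hpath⟩

lemma lintegral_tsum_survivalProd (hQ : IsSkipFreeGenerator Q)
    (hJ : IsJumpDescription μ Q 0 X Y H) {l : ℕ → ℝ} (hl : ∀ i, 0 ≤ l i) (n : ℕ) :
    ∫⁻ ω, ∑' m, survivalProd l n Y H m ω * Set.indicator {n} 1 (Y m ω) ∂μ =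
      (ENNReal.ofReal (harmonicFun Q l n))⁻¹ := by
  have hweight (k : ℕ) : Measurable fun ω => survivalWeight l n (Y k ω) (H k ω) :=
    (measurable_from_prod_countable_right (f := fun p : ℕ × ℝ => survivalWeight l n p.1 p.2)
      (measurable_survivalWeight l n)).comp
        ((hJ.measurable_state k).prodMk (hJ.measurable_holding k).coe_nnreal_real)
  have hmeas (m : ℕ) : Measurable fun ω =>
      survivalProd l n Y H m ω * Set.indicator {n} 1 (Y m ω) :=
    (Finset.measurable_fun_prod _ fun k _ => hweight k).mul
      ((measurable_of_countable (Set.indicator {n} 1)).comp (hJ.measurable_state m))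
  rw [lintegral_tsum fun m => (hmeas m).aemeasurable,
    ← hJ.tsum_lintegral_chainWeight_discount hQ hl n]
  refine tsum_congr fun m => ?_
  simp only [← funext (lintegral_survivalWeight hQ hl n)]
  exact hJ.lintegral_prod_holding_mul hQ (measurable_survivalWeight l n) _ m

-- Without killing, the survival probability up to the hitting time is the probability of hitting.
lemma ae_exists_hitsAt (hQ : IsSkipFreeGenerator Q) (hJ : IsJumpDescription μ Q 0 X Y H) (n : ℕ) :
    ∀ᵐ ω ∂μ, ∃ m, HitsAt n Y m ω := by
  have hhits := measurableSet_exists_hitsAt hJ.measurable_state n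
  have hindicator (ω : Ω) : ∑' m, survivalProd (fun _ => 0) n Y H m ω *
      Set.indicator {n} 1 (Y m ω) = Set.indicator {ω | ∃ m, HitsAt n Y m ω} 1 ω := by
    by_cases hω : ∃ m, HitsAt n Y m ω
    · obtain ⟨m, hm⟩ := id hω
      rw [tsum_survivalProd_of_hitsAt _ hm, Set.indicator_of_mem (by exact hω)]
      simp
    · rw [Set.indicator_of_notMem (by exact hω)]
      exact ENNReal.tsum_eq_zero.mpr fun m =>
        survivalProd_mul_indicator_of_not_hitsAt _ (not_exists.mp hω m)
  have htotal := hJ.lintegral_tsum_survivalProd hQ (l := fun _ => 0) (fun _ => le_rfl) n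
  simp only [hindicator] at htotal
  rw [lintegral_indicator_one hhits, harmonicFun_eq_one hQ (fun _ _ => rfl) n le_rfl,
    ENNReal.ofReal_one, inv_one] at htotal
  exact (prob_compl_eq_zero_iff hhits).mpr htotal

lemma ae_occupationTime_ne_top (hQ : IsSkipFreeGenerator Q)
    (hJ : IsJumpDescription μ Q 0 X Y H) (n i : ℕ) : ∀ᵐ ω ∂μ, occupationTime X n i ω ≠ ∞ := by
  filter_upwards [hJ.ae_followsJumps, hJ.ae_exists_hitsAt hQ n] with ω hX ⟨m, hm⟩
  exact hX.occupationTime_ne_top hm i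

lemma aemeasurable_occupationTime (hQ : IsSkipFreeGenerator Q)
    (hJ : IsJumpDescription μ Q 0 X Y H) (n i : ℕ) : AEMeasurable (occupationTime X n i) μ := by
  have hstay (k : ℕ) : MeasurableSet {ω | Y k ω = i ∧ ∀ j ≤ k, Y j ω < n} := by
    have hinter : {ω | Y k ω = i ∧ ∀ j ≤ k, Y j ω < n} =
        Y k ⁻¹' {i} ∩ ⋂ j ∈ range (k + 1), Y j ⁻¹' Set.Iio n := by
      ext; simp
    rw [hinter]
    exact (hJ.measurable_state k (measurableSet_singleton i)).inter
      (measurableSet_biInter _ fun j _ => hJ.measurable_state j measurableSet_Iio)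
  refine ⟨fun ω => ∑' k, if Y k ω = i ∧ ∀ j ≤ k, Y j ω < n then (H k ω : ℝ≥0∞) else 0,
    Measurable.tsum fun k => Measurable.ite (hstay k)
      (hJ.measurable_holding k).coe_nnreal_ennreal measurable_const, ?_⟩
  filter_upwards [hJ.ae_followsJumps, hJ.ae_exists_hitsAt hQ n] with ω hX ⟨m, hm⟩
  exact hX.occupationTime_eq_tsum hm i

lemma lintegral_exp_occupationTime (hQ : IsSkipFreeGenerator Q)
    (hJ : IsJumpDescription μ Q 0 X Y H) {l : ℕ → ℝ} (hl : ∀ i, 0 ≤ l i) (n : ℕ) :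
    ∫⁻ ω, ENNReal.ofReal
        (Real.exp (-∑ i ∈ range n, l i * (occupationTime X n i ω).toReal)) ∂μ =
      (ENNReal.ofReal (harmonicFun Q l n))⁻¹ := by
  rw [← hJ.lintegral_tsum_survivalProd hQ hl n]
  refine lintegral_congr_ae ?_
  filter_upwards [hJ.ae_followsJumps, hJ.ae_exists_hitsAt hQ n] with ω hX ⟨m, hm⟩
  rw [tsum_survivalProd_of_hitsAt l hm, hX.sum_mul_occupationTime hm]

end IsJumpDescription

end OccupationTime

section LaplaceTransform

/-- The function `x ↦ exp (-x)` on `[0, ∞)`; the polynomials in it are an algebra that separates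
points. -/
noncomputable def expNeg : ℝ≥0 →ᵇ ℝ :=
  .ofNormedAddCommGroup (fun x : ℝ≥0 => Real.exp (-x)) (by fun_prop) 1 fun x => by
    rw [Real.norm_eq_abs, Real.abs_exp, Real.exp_le_one_iff, neg_nonpos]
    exact x.2

lemma expNeg_apply (x : ℝ≥0) : expNeg x = Real.exp (-x) := rfl

lemma expNeg_pow_apply (k : ℕ) (x : ℝ≥0) : (expNeg ^ k) x = Real.exp (-(k * x)) := by
  rw [BoundedContinuousFunction.coe_pow, Pi.pow_apply, expNeg_apply, ← Real.exp_nat_mul, mul_neg]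

lemma integral_aeval_expNeg_eq {P P' : Measure ℝ≥0} [IsFiniteMeasure P] [IsFiniteMeasure P']
    (h : ∀ k : ℕ, ∫ x : ℝ≥0, Real.exp (-(k * x)) ∂P = ∫ x : ℝ≥0, Real.exp (-(k * x)) ∂P')
    (p : Polynomial ℝ) :
    ∫ x, Polynomial.aeval expNeg p x ∂P = ∫ x, Polynomial.aeval expNeg p x ∂P' := by
  induction p using Polynomial.induction_on' with
  | add p q hp hq =>
    simp only [map_add, BoundedContinuousFunction.add_apply]
    rw [integral_add (integrable _ _) (integrable _ _),
      integral_add (integrable _ _) (integrable _ _), hp, hq]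
  | monomial k a =>
    have hval (x : ℝ≥0) : Polynomial.aeval expNeg (Polynomial.monomial k a) x =
        a * Real.exp (-(k * x)) := by
      rw [Polynomial.aeval_monomial, ← Algebra.smul_def, BoundedContinuousFunction.smul_apply,
        expNeg_pow_apply, smul_eq_mul]
    simp only [hval, integral_const_mul, h k]

lemma measure_ext_of_integral_exp_neg_mul {P P' : Measure ℝ≥0} [IsFiniteMeasure P]
    [IsFiniteMeasure P']
    (h : ∀ k : ℕ, ∫ x : ℝ≥0, Real.exp (-(k * x)) ∂P = ∫ x : ℝ≥0, Real.exp (-(k * x)) ∂P') :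
    P = P' := by
  let A : StarSubalgebra ℝ (ℝ≥0 →ᵇ ℝ) :=
    { (Polynomial.aeval (R := ℝ) expNeg).range with
      star_mem' := fun {f} hf => by
        have hstar : star f = f := by ext x; simp
        rwa [hstar] }
  refine ext_of_forall_mem_subalgebra_integral_eq_of_polish (𝕜 := ℝ) (A := A) ?_ ?_
  · intro x y hxy
    refine ⟨expNeg, ⟨toContinuousMapStarₐ ℝ expNeg, ⟨expNeg, ?_, rfl⟩, rfl⟩, fun hexp => ?_⟩
    · exact ⟨Polynomial.X, Polynomial.aeval_X _⟩
    · exact hxy (NNReal.coe_injective (neg_injective (Real.exp_injective hexp)))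
  · rintro f ⟨p, rfl⟩
    exact integral_aeval_expNeg_eq h p

/-- The Laplace kernel `exp (-s x)`; the value `exp 0` at `x = ∞` is a junk value. -/
noncomputable def laplaceKernel (s : ℝ) (x : ℝ≥0∞) : ℝ≥0∞ :=
  ENNReal.ofReal (Real.exp (-(s * x.toReal)))

lemma measurable_laplaceKernel (s : ℝ) : Measurable (laplaceKernel s) := by
  unfold laplaceKernel
  fun_prop

lemma laplaceKernel_zero (x : ℝ≥0∞) : laplaceKernel 0 x = 1 := by simp [laplaceKernel]

lemma laplaceKernel_le_one {s : ℝ} (hs : 0 ≤ s) (x : ℝ≥0∞) : laplaceKernel s x ≤ 1 := by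
  rw [laplaceKernel, ENNReal.ofReal_le_one, Real.exp_le_one_iff, neg_nonpos]
  exact mul_nonneg hs ENNReal.toReal_nonneg

lemma laplaceKernel_add (s t : ℝ) (x : ℝ≥0∞) :
    laplaceKernel (s + t) x = laplaceKernel s x * laplaceKernel t x := by
  rw [laplaceKernel, laplaceKernel, laplaceKernel, ← ENNReal.ofReal_mul (Real.exp_pos _).le,
    ← Real.exp_add, add_mul, neg_add]

lemma ae_eq_of_lintegral_laplaceKernel_mul_eq {ρ : Measure ℝ≥0} {F G : ℝ≥0 → ℝ≥0∞}
    (hF : Measurable F) (hG : Measurable G) (hGfin : ∫⁻ x, G x ∂ρ ≠ ∞)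
    (h : ∀ k : ℕ, ∫⁻ x, laplaceKernel k x * F x ∂ρ = ∫⁻ x, laplaceKernel k x * G x ∂ρ) :
    F =ᵐ[ρ] G := by
  have hFfin : ∫⁻ x, F x ∂ρ ≠ ∞ := by
    have h0 := h 0
    simp only [Nat.cast_zero, laplaceKernel_zero, one_mul] at h0
    rwa [h0]
  have := isFiniteMeasure_withDensity hFfin
  have := isFiniteMeasure_withDensity hGfin
  refine (withDensity_eq_iff hF.aemeasurable hG.aemeasurable hFfin).mp
    (measure_ext_of_integral_exp_neg_mul fun k => ?_)
  have hkernel : Measurable fun x : ℝ≥0 => laplaceKernel k x :=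
    (measurable_laplaceKernel k).comp measurable_coe_nnreal_ennreal
  have hmap {E : ℝ≥0 → ℝ≥0∞} (hE : Measurable E) :
      ∫ x : ℝ≥0, Real.exp (-(k * x)) ∂ρ.withDensity E =
        (∫⁻ x, laplaceKernel k x * E x ∂ρ).toReal := by
    rw [integral_eq_lintegral_of_nonneg_ae (.of_forall fun x => (Real.exp_pos _).le)
      (Measurable.aestronglyMeasurable (by fun_prop))]
    exact congrArg ENNReal.toReal ((lintegral_withDensity_eq_lintegral_mul ρ hE hkernel).trans
      (lintegral_congr fun x => mul_comm _ _))
  rw [hmap hF, hmap hG, h]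

end LaplaceTransform

section ConditionalDistribution

variable {Ω α E : Type*} [MeasurableSpace Ω] [MeasurableSpace α] {μ : Measure Ω}

lemma ae_eq_comp_of_lintegral_laplaceKernel_mul_eq {W : Ω → ℝ≥0∞} (hW : AEMeasurable W μ)
    (hWfin : ∀ᵐ ω ∂μ, W ω ≠ ∞) {F G : ℝ≥0∞ → ℝ≥0∞} (hF : Measurable F) (hG : Measurable G)
    (hGfin : ∫⁻ ω, G (W ω) ∂μ ≠ ∞)
    (h : ∀ k : ℕ, ∫⁻ ω, laplaceKernel k (W ω) * F (W ω) ∂μ =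
      ∫⁻ ω, laplaceKernel k (W ω) * G (W ω) ∂μ) :
    ∀ᵐ ω ∂μ, F (W ω) = G (W ω) := by
  have hmap {E : ℝ≥0∞ → ℝ≥0∞} (hE : Measurable E) :
      ∫⁻ x : ℝ≥0, E x ∂μ.map (fun ω => (W ω).toNNReal) = ∫⁻ ω, E (W ω) ∂μ := by
    refine (lintegral_map' (f := fun x : ℝ≥0 => E x)
      (hE.comp measurable_coe_nnreal_ennreal).aemeasurable hW.ennreal_toNNReal).trans ?_
    exact lintegral_congr_ae (hWfin.mono fun ω hω => congrArg E (ENNReal.coe_toNNReal hω))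
  have hae := ae_eq_of_lintegral_laplaceKernel_mul_eq (hF.comp measurable_coe_nnreal_ennreal)
    (hG.comp measurable_coe_nnreal_ennreal) ((hmap hG).trans_ne hGfin) fun k =>
      (hmap ((measurable_laplaceKernel k).mul hF)).trans
        ((h k).trans (hmap ((measurable_laplaceKernel k).mul hG)).symm)
  filter_upwards [ae_of_ae_map hW.ennreal_toNNReal hae, hWfin] with ω hω hfin
  simpa only [Function.comp_apply, ENNReal.coe_toNNReal hfin] using hω

variable [MeasurableSpace E] [StandardBorelSpace E] [Nonempty E] [IsFiniteMeasure μ]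
  {Z : Ω → α} {V : Ω → E}

lemma lintegral_mul_eq_of_condDistrib_eq {β : Type*} [MeasurableSpace β] {W : Ω → β}
    (hZ : AEMeasurable Z μ) (hV : AEMeasurable V μ)
    (h : ∀ᵐ ω ∂μ, condDistrib V Z μ (Z ω) = condDistrib V W μ (W ω))
    {f : α → ℝ≥0∞} {g : E → ℝ≥0∞} (hf : Measurable f) (hg : Measurable g) :
    ∫⁻ ω, f (Z ω) * g (V ω) ∂μ =
      ∫⁻ ω, f (Z ω) * ∫⁻ v, g v ∂(condDistrib V W μ (W ω)) ∂μ := by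
  have hfg : Measurable fun p : α × E => f p.1 * g p.2 := by fun_prop
  have hG : Measurable fun z => ∫⁻ v, g v ∂(condDistrib V Z μ z) := hg.lintegral_kernel
  calc ∫⁻ ω, f (Z ω) * g (V ω) ∂μ
      = ∫⁻ p, f p.1 * g p.2 ∂(μ.map fun ω => (Z ω, V ω)) :=
        (lintegral_map' hfg.aemeasurable (hZ.prodMk hV)).symm
    _ = ∫⁻ z, f z * ∫⁻ v, g v ∂(condDistrib V Z μ z) ∂(μ.map Z) := by
        rw [← compProd_map_condDistrib hV, Measure.lintegral_compProd hfg]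
        exact lintegral_congr fun z => lintegral_const_mul (f z) hg
    _ = ∫⁻ ω, f (Z ω) * ∫⁻ v, g v ∂(condDistrib V Z μ (Z ω)) ∂μ :=
        lintegral_map' (hf.mul hG).aemeasurable hZ
    _ = _ := lintegral_congr_ae (h.mono fun ω hω => by simp only [hω])

lemma lintegral_mul_eq_of_condDistrib_eq_of_laplace {w : α → ℝ≥0∞} (hw : Measurable w)
    (hZ : AEMeasurable Z μ) (hV : AEMeasurable V μ) (hfin : ∀ᵐ ω ∂μ, w (Z ω) ≠ ∞)
    (h : ∀ᵐ ω ∂μ,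
      condDistrib V Z μ (Z ω) = condDistrib V (fun ω => w (Z ω)) μ (w (Z ω)))
    {g : E → ℝ≥0∞} {G : ℝ≥0∞ → ℝ≥0∞} (hg : Measurable g) (hG : Measurable G)
    (hGfin : ∫⁻ ω, G (w (Z ω)) ∂μ ≠ ∞)
    (hlaplace : ∀ k : ℕ, ∫⁻ ω, laplaceKernel k (w (Z ω)) * g (V ω) ∂μ =
      ∫⁻ ω, laplaceKernel k (w (Z ω)) * G (w (Z ω)) ∂μ)
    {f : α → ℝ≥0∞} (hf : Measurable f) :
    ∫⁻ ω, f (Z ω) * g (V ω) ∂μ = ∫⁻ ω, f (Z ω) * G (w (Z ω)) ∂μ := by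
  have hcond {f : α → ℝ≥0∞} (hf : Measurable f) :=
    lintegral_mul_eq_of_condDistrib_eq hZ hV h hf hg
  have hae := ae_eq_comp_of_lintegral_laplaceKernel_mul_eq (hw.comp_aemeasurable hZ) hfin
    hg.lintegral_kernel hG hGfin fun k =>
      (hcond ((measurable_laplaceKernel k).comp hw)).symm.trans (hlaplace k)
  rw [hcond hf]
  exact lintegral_congr_ae (hae.mono fun ω hω => congrArg (f (Z ω) * ·) hω)

end ConditionalDistribution

section MarkovProperty

lemma inv_ofReal_eq_mul_inv_ofReal_iff {a b c : ℝ} (ha : 0 < a) (hb : 0 < b) (hc : 0 < c) :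
    (ENNReal.ofReal b)⁻¹ = ENNReal.ofReal a * (ENNReal.ofReal c)⁻¹ ↔ a * b = c := by
  rw [← ENNReal.ofReal_inv_of_pos hb, ← ENNReal.ofReal_inv_of_pos hc, ← ENNReal.ofReal_mul ha.le,
    ENNReal.ofReal_eq_ofReal_iff (by positivity) (by positivity)]
  field_simp
  rw [eq_comm]

variable {Ω : Type*} [MeasurableSpace Ω] {μ : Measure Ω} [IsProbabilityMeasure μ]
  {Q : Matrix ℕ ℕ ℝ} {X : ℝ≥0 → Ω → ℕ} {Y : ℕ → Ω → ℕ} {H : ℕ → Ω → ℝ≥0} {i j n : ℕ}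

namespace IsJumpDescription

lemma lintegral_laplaceKernel_occupationTime (hQ : IsSkipFreeGenerator Q)
    (hJ : IsJumpDescription μ Q 0 X Y H) (hn : i + 2 < n) {s t u : ℝ} (hs : 0 ≤ s)
    (ht : 0 ≤ t) (hu : 0 ≤ u) :
    ∫⁻ ω, laplaceKernel s (occupationTime X n i ω) *
        (laplaceKernel t (occupationTime X n (i + 1) ω) *
          laplaceKernel u (occupationTime X n (i + 2) ω)) ∂μ =
      (ENNReal.ofReal (harmonicFun Q (killingRates i s t u) n))⁻¹ := by
  rw [← hJ.lintegral_exp_occupationTime hQ (killingRates_nonneg hs ht hu) n]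
  refine lintegral_congr fun ω => ?_
  have hsum : ∑ k ∈ range n, killingRates i s t u k * (occupationTime X n k ω).toReal =
      s * (occupationTime X n i ω).toReal + (t * (occupationTime X n (i + 1) ω).toReal +
        u * (occupationTime X n (i + 2) ω).toReal) := by
    rw [← sum_subset (s₁ := {i, i + 1, i + 2})]
    · simp [killingRates]
    · intro k hk
      simp only [mem_insert, mem_singleton] at hk
      rw [mem_range]
      omega
    · intro k _ hk
      simp only [mem_insert, mem_singleton, not_or] at hk
      simp [killingRates, hk]
  rw [hsum, neg_add, neg_add, Real.exp_add, Real.exp_add, ENNReal.ofReal_mul (Real.exp_pos _).le,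
    ENNReal.ofReal_mul (Real.exp_pos _).le, laplaceKernel, laplaceKernel, laplaceKernel]

lemma lintegral_laplaceKernel_occupationTime_eq_iff (hQ : IsSkipFreeGenerator Q)
    (hJ : IsJumpDescription μ Q 0 X Y H) (hn : i + 2 < n) {A γ s t : ℝ} (hA : 0 < A)
    (hγ : 0 ≤ γ) (hs : 0 ≤ s) (ht : 0 ≤ t) :
    ∫⁻ ω, laplaceKernel s (occupationTime X n i ω) *
        (laplaceKernel t (occupationTime X n (i + 1) ω) *
          laplaceKernel 1 (occupationTime X n (i + 2) ω)) ∂μ =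
      ∫⁻ ω, laplaceKernel s (occupationTime X n i ω) *
        (laplaceKernel t (occupationTime X n (i + 1) ω) *
          (ENNReal.ofReal A * laplaceKernel γ (occupationTime X n (i + 1) ω))) ∂μ ↔
    A * harmonicFun Q (killingRates i s t 1) n =
      harmonicFun Q (killingRates i s (t + γ) 0) n := by
  have hpos {t u : ℝ} (ht : 0 ≤ t) (hu : 0 ≤ u) : 0 < harmonicFun Q (killingRates i s t u) n :=
    zero_lt_one.trans_le (one_le_harmonicFun hQ (killingRates_nonneg hs ht hu) n)
  have hshift := hJ.lintegral_laplaceKernel_occupationTime hQ hn hs (add_nonneg ht hγ) le_rfl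
  simp only [laplaceKernel_zero, mul_one, laplaceKernel_add] at hshift
  simp only [mul_left_comm _ (ENNReal.ofReal A)]
  rw [lintegral_const_mul' _ _ ENNReal.ofReal_ne_top, hshift,
    hJ.lintegral_laplaceKernel_occupationTime hQ hn hs ht zero_le_one]
  exact inv_ofReal_eq_mul_inv_ofReal_iff hA (hpos ht zero_le_one) (hpos (add_nonneg ht hγ) le_rfl)

lemma not_condDistrib_occupationTime_eq (hQ : IsSkipFreeGenerator Q)
    (hJ : IsJumpDescription μ Q 0 X Y H) (hn : i + 2 < n) (hj : j ≤ i) (hpos : 0 < Q (i + 2) j) :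
    ¬∀ᵐ ω ∂μ, condDistrib (occupationTime X n (i + 2))
        (fun ω' (k : Fin (i + 2)) => occupationTime X n k ω') μ
        (fun k : Fin (i + 2) => occupationTime X n k ω) =
      condDistrib (occupationTime X n (i + 2)) (occupationTime X n (i + 1)) μ
        (occupationTime X n (i + 1) ω) := by
  intro hmarkov
  obtain ⟨A, γ, s, hA, hγ, hs, hscale, hne⟩ :=
    exists_scaling_harmonicFun_killingRates hQ hn hj hpos
  have hmeas := hJ.aemeasurable_occupationTime hQ n
  have hlaplace {s t : ℝ} (hs : 0 ≤ s) (ht : 0 ≤ t) :=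
    hJ.lintegral_laplaceKernel_occupationTime_eq_iff hQ hn hA hγ hs ht
  have hbound : ∫⁻ ω, ENNReal.ofReal A * laplaceKernel γ (occupationTime X n (i + 1) ω) ∂μ ≠ ∞ :=
    ((lintegral_mono fun ω => mul_le_of_le_one_right' (laplaceKernel_le_one hγ _)).trans_lt
      (by simp)).ne
  have hzero (k : ℕ) := (hlaplace le_rfl k.cast_nonneg).mpr (hscale k)
  simp only [laplaceKernel_zero, one_mul] at hzero
  have hmarkovEq := lintegral_mul_eq_of_condDistrib_eq_of_laplace
    (Z := fun ω (k : Fin (i + 2)) => occupationTime X n k ω) (w := fun z => z (Fin.last (i + 1)))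
    (f := fun z => laplaceKernel s (z (Fin.castSucc (Fin.last i))))
    (G := fun x => ENNReal.ofReal A * laplaceKernel γ x)
    (measurable_pi_apply _) (aemeasurable_pi_lambda _ fun k => hmeas k) (hmeas (i + 2))
    (hJ.ae_occupationTime_ne_top hQ n (i + 1)) hmarkov (measurable_laplaceKernel 1)
    ((measurable_laplaceKernel γ).const_mul _) hbound hzero
    ((measurable_laplaceKernel s).comp (measurable_pi_apply _))
  have hnonzero := (hlaplace hs le_rfl).mp
    (by simp only [laplaceKernel_zero, one_mul]; exact hmarkovEq)
  exact hne (by rwa [zero_add] at hnonzero)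

end IsJumpDescription

end MarkovProperty

end SkipFree

theorem lemma2 (Q : Matrix ℕ ℕ ℝ) (hQ : SkipFree.IsSkipFreeGenerator Q) (n : ℕ)
    (hn : ¬ SkipFree.IsTridiagonal (SkipFree.upperSubmatrix Q n))
    {Ω : Type*} [MeasurableSpace Ω] (μ : MeasureTheory.Measure Ω)
    [MeasureTheory.IsProbabilityMeasure μ] (X : ℝ≥0 → Ω → ℕ)
    (hX : SkipFree.IsMarkovProcessFrom μ Q 0 X) :
    ¬ SkipFree.HasMarkovProperty μ
      (fun i : Fin n => SkipFree.occupationTime X n (i : ℕ)) := by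
  obtain ⟨-, Y, H, hJ⟩ := hX
  simp only [SkipFree.IsTridiagonal, not_forall, SkipFree.upperSubmatrix,
    Matrix.submatrix_apply] at hn
  obtain ⟨a, b, hab, hne⟩ := hn
  rcases hab with hup | hdown
  · exact absurd (hQ.skip_free a b hup) hne
  obtain ⟨i, hi⟩ : ∃ i, (a : ℕ) = i + 2 := ⟨a - 2, by omega⟩
  have hin : i + 2 < n := hi ▸ a.2
  have hpos : 0 < Q (i + 2) b :=
    hi ▸ lt_of_le_of_ne (hQ.nonneg_of_ne a b (by omega)) (Ne.symm hne)
  exact fun hmarkov =>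
    hJ.not_condDistrib_occupationTime_eq hQ hin (by omega) hpos (hmarkov (i + 1) hin)
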